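/- **Clar covers.** Let $G$ be a finite simple graph. A *Clar cover* of $G$ is a spanning subgraph of $G$ each of whose connected components is either a complete graph $K_2$ or a hexagon (6-cycle) $C_6$; its *order* is the number of its components that are hexagons. Let $c_k$ be the number of Clar covers of $G$ of order $k$ and $Cl$ the maximal order of a Clar cover (the Clar number). The *Zhang–Zhang (Clar covering) polynomial* of $G$ is $\mathrm{ZZ}(G,x)=\sum_{k=0}^{Cl}c_k x^k$. **Parallelograms and ribbons.** Consider the honeycomb lattice of regular hexagons with two vertical edges each, and let $(i,j)$ denote the hexagon reached from a fixed hexagon $(0,0)$ by $i$ steps to the lower-left neighbour and $j$ steps to the lower-right neighbour. A finite set of hexagons determines the graph consisting of all their vertices and sides. For integers $m,n\ge 0$, the parallelogram $M(m,n)$ is the graph of the hexagons $(i,j)$ with $0\le i<n$, $0\le j<m$. For integers $n_1,n_2,m_1,m_2\ge 0$, the ribbon $Rb(n_1,n_2,m_1,m_2)$ is the graph of the hexagons $(i,j)$ with $0\le i<n_1+n_2$, $0\le j<m_1$ (upper arm) or $n_2\le i<n_1+n_2$, $0\le j<m_1+m_2$ (lower arm). (The graph of the empty set of hexagons is empty,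 and its ZZ polynomial is $1$.) For $k_1\le n$ and $k_2\le m$ put $V(k_1,k_2,m,n)=Rb(k_1,n-k_1,k_2,m-k_2)$, and for $k\le m$, $k\le n$ put $V(k,m,n)=V(k,k,m,n)$. **Theorem.** For all integers $n_1,n_2,m_1,m_2\ge 0$, $$\mathrm{ZZ}(Rb(n_1,n_2,m_1,m_2),x)=\sum_{k=0}^{\min(n_1,m_1)}\mathrm{ZZ}(M(m_1-k,n_2+k),x)\,\mathrm{ZZ}(M(m_2+k,n_1-k),x)+x\sum_{k=1}^{\min(n_1,m_1)}\mathrm{ZZ}(M(m_1-k,n_2-1+k),x)\,\mathrm{ZZ}(M(m_2-1+k,n_1-k),x).$$ For all $m,n\ge 0$, $$\mathrm{ZZ}(M(m,n),x)=\sum_{j=0}^{\min(m,n)}\binom mj\binom nj(1+x)^j={}_2F_1(-m,-n;1;1+x).$$ Consequently $$\mathrm{ZZ}(Rb(n_1,n_2,m_1,m_2),x)=\sum_{k=0}^{\min(n_1,m_1)}{}_2F_1(-m_1+k,-n_2-k;1;1+x)\,{}_2F_1(-n_1+k,-m_2-k;1;1+x)+x\sum_{k=1}^{\min(n_1,m_1)}{}_2F_1(-m_1+k,-n_2+1-k;1;1+x)\,{}_2F_1(-n_1+k,-m_2+1-k;1;1+x)$$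 (for every complex number $x$), that is, $$\mathrm{ZZ}(Rb(n_1,n_2,m_1,m_2),x)=\sum_{k=0}^{\min(n_1,m_1)}\sum_{j=0}^{m_1-k}\sum_{i=0}^{n_1-k}\binom{m_1-k}{j}\binom{n_2+k}{j}\binom{m_2+k}{i}\binom{n_1-k}{i}(1+x)^{i+j}+x\sum_{k=1}^{\min(n_1,m_1)}\sum_{j=0}^{m_1-k}\sum_{i=0}^{n_1-k}\binom{m_1-k}{j}\binom{n_2-1+k}{j}\binom{m_2-1+k}{i}\binom{n_1-k}{i}(1+x)^{i+j}.$$ In particular, for $0\le k\le\min(m,n)$, $$\mathrm{ZZ}(V(k,m,n),x)=\sum_{s=0}^{k}\sum_{j=0}^{k-s}\sum_{i=0}^{k-s}\binom{k-s}{j}\binom{n-k+s}{j}\binom{m-k+s}{i}\binom{k-s}{i}(1+x)^{i+j}+x\sum_{s=1}^{k}\sum_{j=0}^{k-s}\sum_{i=0}^{k-s}\binom{k-s}{j}\binom{n-k-1+s}{j}\binom{m-k-1+s}{i}\binom{k-s}{i}(1+x)^{i+j},$$ and, for $0\le k_1\le n$ and $0\le k_2\le m$, $$\mathrm{ZZ}(V(k_1,k_2,m,n),x)=\sum_{k=0}^{\min(k_1,k_2)}\sum_{j=0}^{k_2-k}\sum_{i=0}^{k_1-k}\binom{k_2-k}{j}\binom{n-k_1+k}{j}\binom{m-k_2+k}{i}\binom{k_1-k}{i}(1+x)^{i+j}+x\sum_{k=1}^{\min(k_1,k_2)}\sum_{j=0}^{k_2-k}\sum_{i=0}^{k_1-k}\binom{k_2-k}{j}\binom{n-k_1-1+k}{j}\binom{m-k_2-1+k}{i}\binom{k_1-k}{i}(1+x)^{i+j}.$$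 -/

import Mathlib

open Polynomial

noncomputable section

/-! ### Clar covers and the Zhang-Zhang polynomial of a graph -/

section ClarCovers

variable {V : Type*}

/-- A connected component of `H` that is a complete graph on two vertices (a double bond). -/
def IsDoubleBond {H : SimpleGraph V} (c : H.ConnectedComponent) : Prop :=
  Nonempty (c.toSimpleGraph ≃g (⊤ : SimpleGraph (Fin 2)))

/-- A connected component of `H` that is a cycle on six vertices (an aromatic sextet). -/
def IsSextet {H : SimpleGraph V} (c : H.ConnectedComponent) : Prop :=
  Nonempty (c.toSimpleGraph ≃g SimpleGraph.cycleGraph 6)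

/-- A Clar cover of `G`: a spanning subgraph, i.e. a graph `H ≤ G` on the same vertex set, each of
whose connected components is a `K₂` or a hexagon `C₆`. -/
def IsClarCover (G H : SimpleGraph V) : Prop :=
  H ≤ G ∧ ∀ c : H.ConnectedComponent, IsDoubleBond c ∨ IsSextet c

/-- The order of a Clar cover: its number of hexagons. -/
def clarOrder (H : SimpleGraph V) : ℕ :=
  {c : H.ConnectedComponent | IsSextet c}.ncard

/-- The number `c_k` of Clar covers of order `k`. -/
def clarCount (G : SimpleGraph V) (k : ℕ) : ℕ :=
  {H : SimpleGraph V | IsClarCover G H ∧ clarOrder H = k}.ncard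

/-- The Clar number of a finite graph: the maximal order of a Clar cover. -/
def clarNumber (G : SimpleGraph V) : ℕ :=
  sSup {k : ℕ | ∃ H : SimpleGraph V, IsClarCover G H ∧ clarOrder H = k}

/-- The Zhang-Zhang (Clar covering) polynomial `∑_{k=0}^{Cl} c_k x^k` of a finite graph. -/
def ZZ [Finite V] (G : SimpleGraph V) : ℤ[X] :=
  ∑ k ∈ Finset.range (clarNumber G + 1), C (clarCount G k : ℤ) * X ^ k

end ClarCovers

/-! ### Benzenoids as finite unions of hexagonal cells of the honeycomb lattice

The cell `(i, j)` is reached from the cell `(0, 0)` by `i` steps to the lower left neighbour and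
`j` steps to the lower right neighbour. In the plane, with the horizontal axis measured in units
of `√3` (so that the hexagons are regular, with two vertical edges and with sides of length `2`),
it is centred at `(j - i, -3 (i + j))`. -/

/-- The corners of a regular hexagon centred at the origin, in cyclic order, starting at the top. -/
def hexOffset : Fin 6 → ℤ × ℤ :=
  ![(0, 2), (1, 1), (1, -1), (0, -2), (-1, -1), (-1, 1)]

/-- The `t`-th corner of the cell `c`. -/
def hexCorner (c : ℤ × ℤ) (t : Fin 6) : ℤ × ℤ :=
  (c.2 - c.1, -3 * (c.1 + c.2)) + hexOffset t

/-- All corners of the cells in `S`. -/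
def benzenoidVertices (S : Finset (ℤ × ℤ)) : Finset (ℤ × ℤ) :=
  S.biUnion fun c => Finset.univ.image (hexCorner c)

/-- The graph formed by all corners and all sides of the hexagonal cells in `S`. -/
def benzenoid (S : Finset (ℤ × ℤ)) : SimpleGraph (benzenoidVertices S) :=
  SimpleGraph.fromRel fun p q =>
    ∃ c ∈ S, ∃ t : Fin 6, p.val = hexCorner c t ∧ q.val = hexCorner c (t + 1)

/-- The cells of the parallelogram with `n` cells in the lower left direction and `m` cells in the
lower right direction. -/
def parallelogramCells (m n : ℕ) : Finset (ℤ × ℤ) :=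
  Finset.Ico (0 : ℤ) n ×ˢ Finset.Ico (0 : ℤ) m

/-- The parallelogram `M(m, n)`. -/
def parallelogram (m n : ℕ) : SimpleGraph (benzenoidVertices (parallelogramCells m n)) :=
  benzenoid (parallelogramCells m n)

/-- The cells of the ribbon: an upper arm with `n₁ + n₂` cells in the lower left direction and
`m₁` cells in the lower right direction, and a lower arm with `n₁` cells in the lower left
direction and `m₁ + m₂` cells in the lower right direction; they overlap in an `m₁ × n₁`
parallelogram, at the lower left end of the upper arm and the upper left end of the lower arm. -/
def ribbonCells (n₁ n₂ m₁ m₂ : ℕ) : Finset (ℤ × ℤ) :=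
  Finset.Ico (0 : ℤ) (n₁ + n₂) ×ˢ Finset.Ico (0 : ℤ) m₁ ∪
    Finset.Ico (n₂ : ℤ) (n₁ + n₂) ×ˢ Finset.Ico (0 : ℤ) (m₁ + m₂)

/-- The ribbon `Rb(n₁, n₂, m₁, m₂)`. -/
def ribbon (n₁ n₂ m₁ m₂ : ℕ) : SimpleGraph (benzenoidVertices (ribbonCells n₁ n₂ m₁ m₂)) :=
  benzenoid (ribbonCells n₁ n₂ m₁ m₂)

/-- The ribbon `V(k₁, k₂, m, n)`, for `k₁ ≤ n` and `k₂ ≤ m`: the ribbon with `n₁ = k₁`, `m₁ = k₂`,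
`m = m₁ + m₂` and `n = n₁ + n₂`. -/
def ribbonV₂ (k₁ k₂ m n : ℕ) :
    SimpleGraph (benzenoidVertices (ribbonCells k₁ (n - k₁) k₂ (m - k₂))) :=
  ribbon k₁ (n - k₁) k₂ (m - k₂)

/-- The ribbon `V(k, m, n)`, for `k ≤ m` and `k ≤ n`: the ribbon with `n₁ = m₁ = k`,
`m = m₁ + m₂` and `n = n₁ + n₂`. -/
def ribbonV (k m n : ℕ) :
    SimpleGraph (benzenoidVertices (ribbonCells k (n - k) k (m - k))) :=
  ribbon k (n - k) k (m - k)

end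

noncomputable section

/-! ### Tiles of a spanning subgraph -/

section Tiles

open SimpleGraph Set

variable {V κ : Type*}

/-! Clar covers of a ribbon are encoded by lattice paths. The grid point `(i, j)` stands for the
vertical edge whose lower end is the top corner of the cell `(i, j)`. Every vertex of a nonempty
ribbon with `n₁ ≥ 1` has its vertical partner, except two: a topmost vertex (the source, which is
only a lower end) and a bottommost one (the sink, which is only an upper end). The source must lie
in the bond to its lower right, in the bond to its lower left, or in the hexagon below it. Deleting
that component leaves exactly one new lower end without its partner, at `(i, j + 1)`, `(i + 1, j)`
or `(i + 1, j + 1)`, and the argument repeats. When the path reaches `(n₁ + n₂, m₁ + m₂)`, what is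
left is a union of vertical edges, and these have a single cover: the lowest vertex can only be
joined upwards. So the polynomial counts the paths with unit and diagonal steps in an L-shaped
region, each diagonal step having weight `X`. The peeling is `coverPoly_of_two_neighbors` and
`coverPoly_of_unique_neighbor`; the correspondence is `ribbon_coverPoly_of_pathState`.

For a parallelogram the region is a rectangle and the count is a Delannoy polynomial, whose binomial
form comes from Pascal's rule and `X = (1 + X) - 1`. For a ribbon, the paths are cut at the
antidiagonal `i + j = n₂ + m₁` through the inner corner of the L. A path meets it at a point `(n₂ +
k, m₁ - k)` or jumps over it by a diagonal step. Before the cut the path stays in the upper arm,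
after it in the lower arm, and neither half feels the inner corner, so each half is a Delannoy
polynomial. The points give the first sum of the theorem and the diagonal jumps give the sum with
prefactor `X`. -/

/-- `f` is an isomorphism of `K` onto a union of connected components of `H`. -/
def IsTile (K : SimpleGraph κ) (H : SimpleGraph V) (f : κ → V) : Prop :=
  Function.Injective f ∧ ∀ t w, H.Adj (f t) w ↔ ∃ s, K.Adj t s ∧ f s = w

namespace IsTile

variable {K : SimpleGraph κ} {H : SimpleGraph V} {f : κ → V}

lemma adj_iff (h : IsTile K H f) {s t : κ} : H.Adj (f s) (f t) ↔ K.Adj s t := by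
  rw [h.2]
  constructor
  · rintro ⟨r, hr, he⟩
    rwa [← h.1 he]
  · exact fun hst => ⟨t, hst, rfl⟩

lemma mem_range_of_adj (h : IsTile K H f) {v w : V} (hv : v ∈ range f) (hvw : H.Adj v w) :
    w ∈ range f := by
  obtain ⟨t, rfl⟩ := hv
  obtain ⟨s, -, rfl⟩ := (h.2 t w).1 hvw
  exact mem_range_self s

/-- The image is connected because `K` is, and a walk in `H` cannot leave it. -/
lemma range_eq_supp (h : IsTile K H f) (hK : K.Preconnected) (t : κ) :
    range f = (H.connectedComponentMk (f t)).supp := by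
  apply Subset.antisymm
  · rintro _ ⟨s, rfl⟩
    rw [ConnectedComponent.mem_supp_iff, ConnectedComponent.eq]
    exact (hK s t).map (⟨f, fun hst => h.adj_iff.2 hst⟩ : K →g H)
  · intro v hv
    rw [ConnectedComponent.mem_supp_iff, ConnectedComponent.eq] at hv
    obtain ⟨p⟩ := hv.symm
    have key : ∀ {a b : V} (_ : H.Walk a b), a ∈ range f → b ∈ range f := by
      intro a b q
      induction q with
      | nil => exact id
      | cons hab _ ih => exact fun ha => ih (h.mem_range_of_adj ha hab)
    exact key p (mem_range_self t)

lemma range_eq_supp_of_mem (h : IsTile K H f) (hK : K.Preconnected) {v : V} (hv : v ∈ range f) :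
    range f = (H.connectedComponentMk v).supp := by
  obtain ⟨t, rfl⟩ := hv
  exact h.range_eq_supp hK t

lemma comp_iso (h : IsTile K H f) (σ : K ≃g K) : IsTile K H (f ∘ σ) := by
  refine ⟨h.1.comp σ.injective, fun t w => ?_⟩
  rw [Function.comp_apply, h.2]
  constructor
  · rintro ⟨s, hs, rfl⟩
    exact ⟨σ.symm s, by rw [← σ.map_adj_iff]; simpa using hs, by simp⟩
  · rintro ⟨s, hs, rfl⟩
    exact ⟨σ s, σ.map_adj_iff.2 hs, rfl⟩

end IsTile

/-- Labelled embeddings replace isomorphisms of component subtypes, so that components can be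
compared between different graphs on `V`. -/
lemma nonempty_iso_iff_exists_isTile {K : SimpleGraph κ} {H : SimpleGraph V}
    (c : H.ConnectedComponent) :
    Nonempty (c.toSimpleGraph ≃g K) ↔ ∃ f, IsTile K H f ∧ range f = c.supp := by
  constructor
  · rintro ⟨φ⟩
    refine ⟨fun t => (φ.symm t).1, ⟨fun s t hst => φ.symm.injective (Subtype.ext hst), ?_⟩, ?_⟩
    · intro t w
      constructor
      · intro h
        have hw : w ∈ c.supp := c.mem_supp_of_adj_mem_supp (φ.symm t).2 h
        refine ⟨φ ⟨w, hw⟩, ?_, by simp⟩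
        rw [← φ.symm.map_adj_iff, φ.symm_apply_apply]
        exact h
      · rintro ⟨s, hs, rfl⟩
        rw [← φ.symm.map_adj_iff] at hs
        simpa [ConnectedComponent.toSimpleGraph] using hs
    · ext v
      constructor
      · rintro ⟨t, rfl⟩
        exact (φ.symm t).2
      · exact fun hv => ⟨φ ⟨v, hv⟩, by simp⟩
  · rintro ⟨f, hf, hr⟩
    have hm : ∀ t, f t ∈ c.supp := fun t => hr ▸ mem_range_self t
    let e : κ ≃ c := Equiv.ofBijective (fun t => (⟨f t, hm t⟩ : c))
      ⟨fun s t hst => hf.1 (congrArg Subtype.val hst), fun ⟨v, hv⟩ => by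
        have : v ∈ range f := by rw [hr]; exact hv
        obtain ⟨t, rfl⟩ := this
        exact ⟨t, rfl⟩⟩
    refine ⟨(RelIso.mk e ?_ : K ≃g c.toSimpleGraph).symm⟩
    intro s t
    exact hf.adj_iff

lemma connected_top_two : (⊤ : SimpleGraph (Fin 2)).Connected := connected_top

lemma connected_cycleGraph_six : (cycleGraph 6).Connected := cycleGraph_connected

lemma isDoubleBond_iff {H : SimpleGraph V} (c : H.ConnectedComponent) :
    IsDoubleBond c ↔ ∃ f, IsTile (⊤ : SimpleGraph (Fin 2)) H f ∧ range f = c.supp :=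
  nonempty_iso_iff_exists_isTile c

lemma isSextet_iff {H : SimpleGraph V} (c : H.ConnectedComponent) :
    IsSextet c ↔ ∃ f, IsTile (cycleGraph 6) H f ∧ range f = c.supp :=
  nonempty_iso_iff_exists_isTile c

/-- The vertex sets of the hexagonal components of `H`. -/
def sextetSets (H : SimpleGraph V) : Set (Set V) :=
  {T | ∃ f, IsTile (cycleGraph 6) H f ∧ range f = T}

/-- The type of components depends on `H`; sets of vertices do not, and so survive the removal of a
tile. -/
lemma clarOrder_eq_ncard_sextetSets (H : SimpleGraph V) :
    clarOrder H = (sextetSets H).ncard := by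
  rw [clarOrder, ← ncard_image_of_injective _ ConnectedComponent.supp_injective]
  congr 1
  ext T
  constructor
  · rintro ⟨c, hc, rfl⟩
    exact (isSextet_iff c).1 hc
  · rintro ⟨f, hf, rfl⟩
    have h := hf.range_eq_supp connected_cycleGraph_six.preconnected 0
    exact ⟨_, (isSextet_iff _).2 ⟨f, hf, h⟩, h.symm⟩

/-- A subgraph of `G` with vertex set `W` all of whose components are double bonds or hexagons,
regarded as a graph on all vertices of `G`. -/
structure IsPartialClarCover (G : SimpleGraph V) (W : Set V) (H : SimpleGraph V) : Prop where
  le : H ≤ G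
  mem_of_adj : ∀ {v w}, H.Adj v w → v ∈ W
  exists_tile : ∀ v ∈ W, (∃ f, IsTile (⊤ : SimpleGraph (Fin 2)) H f ∧ v ∈ range f) ∨
    ∃ f, IsTile (cycleGraph 6) H f ∧ v ∈ range f

lemma isClarCover_iff_isPartialClarCover_univ (G H : SimpleGraph V) :
    IsClarCover G H ↔ IsPartialClarCover G univ H := by
  constructor
  · rintro ⟨hle, h⟩
    refine ⟨hle, fun _ => mem_univ _, fun v _ => ?_⟩
    have hv : v ∈ (H.connectedComponentMk v).supp := rfl
    refine (h (H.connectedComponentMk v)).imp (fun hc => ?_) (fun hc => ?_)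
    · obtain ⟨f, hf, hr⟩ := (isDoubleBond_iff _).1 hc
      exact ⟨f, hf, hr ▸ hv⟩
    · obtain ⟨f, hf, hr⟩ := (isSextet_iff _).1 hc
      exact ⟨f, hf, hr ▸ hv⟩
  · rintro ⟨hle, -, h⟩
    refine ⟨hle, fun c => ?_⟩
    obtain ⟨v, rfl⟩ := c.exists_rep
    refine (h v (mem_univ v)).imp (fun ⟨f, hf, hv⟩ => ?_) (fun ⟨f, hf, hv⟩ => ?_)
    · exact (isDoubleBond_iff _).2 ⟨f, hf, hf.range_eq_supp_of_mem connected_top_two.preconnected hv⟩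
    · exact (isSextet_iff _).2
        ⟨f, hf, hf.range_eq_supp_of_mem connected_cycleGraph_six.preconnected hv⟩

variable [Finite V]

/-- The finite set of partial Clar covers with vertex set `W`. -/
def partialClarCovers (G : SimpleGraph V) (W : Set V) : Finset (SimpleGraph V) :=
  (toFinite {H | IsPartialClarCover G W H}).toFinset

/-- The Clar covering polynomial of the subgraph of `G` induced on `W`. -/
def coverPoly (G : SimpleGraph V) (W : Set V) : ℤ[X] :=
  ∑ H ∈ partialClarCovers G W, X ^ (sextetSets H).ncard

lemma mem_partialClarCovers {G : SimpleGraph V} {W : Set V} {H : SimpleGraph V} :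
    H ∈ partialClarCovers G W ↔ IsPartialClarCover G W H := by
  simp [partialClarCovers]

lemma ZZ_eq_coverPoly_univ (G : SimpleGraph V) : ZZ G = coverPoly G univ := by
  classical
  have hmem : ∀ H, H ∈ partialClarCovers G univ ↔ IsClarCover G H := fun H => by
    rw [mem_partialClarCovers, isClarCover_iff_isPartialClarCover_univ]
  have hfin : {k : ℕ | ∃ H : SimpleGraph V, IsClarCover G H ∧ clarOrder H = k}.Finite := by
    refine ((partialClarCovers G univ).image clarOrder).finite_toSet.subset ?_
    rintro k ⟨H, hH, rfl⟩
    exact Finset.mem_coe.2 (Finset.mem_image_of_mem _ ((hmem H).2 hH))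
  rw [coverPoly, ZZ, ← Finset.sum_fiberwise_of_maps_to (g := clarOrder)
    (t := Finset.range (clarNumber G + 1))]
  · refine Finset.sum_congr rfl fun k _ => ?_
    have hk : clarCount G k = ((partialClarCovers G univ).filter fun H => clarOrder H = k).card := by
      rw [clarCount, ← ncard_coe_finset]
      congr 1
      ext H
      simp [hmem]
    rw [Finset.sum_congr rfl (g := fun _ => X ^ k), Finset.sum_const, hk]
    · simp
    · intro H hH
      rw [← clarOrder_eq_ncard_sextetSets, (Finset.mem_filter.1 hH).2]
  · intro H hH
    -- The orders form a bounded set, so the supremum defining the Clar number really is an upper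
    -- bound.
    rw [Finset.mem_range, Nat.lt_succ_iff]
    exact le_csSup hfin.bddAbove ⟨H, (hmem H).1 hH, rfl⟩

end Tiles

/-! ### Removing and adding a tile -/

section TileSurgery

open SimpleGraph Set

variable {V κ : Type*}

/-- Delete all edges meeting `R`. -/
def isolate (H : SimpleGraph V) (R : Set V) : SimpleGraph V where
  Adj a b := H.Adj a b ∧ a ∉ R ∧ b ∉ R
  symm := ⟨fun _ _ h => ⟨h.1.symm, h.2.2, h.2.1⟩⟩
  loopless := ⟨fun _ h => H.loopless.irrefl _ h.1⟩

variable {K : SimpleGraph κ} {H : SimpleGraph V} {f : κ → V}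

lemma IsTile.isolate_of_disjoint (h : IsTile K H f) {R : Set V} (hR : Disjoint (range f) R) :
    IsTile K (isolate H R) f := by
  have hn : ∀ t, f t ∉ R := fun t ht => hR.notMem_of_mem_left (mem_range_self t) ht
  refine ⟨h.1, fun t w => ?_⟩
  rw [← h.2]
  refine ⟨fun hw => hw.1, fun hw => ⟨hw, hn t, ?_⟩⟩
  obtain ⟨s, -, rfl⟩ := (h.2 t w).1 hw
  exact hn s

lemma IsTile.eq_or_disjoint_range {κ' : Type*} {K' : SimpleGraph κ'} {g : κ' → V}
    (hf : IsTile K H f) (hg : IsTile K' H g) (hK : K.Preconnected) (hK' : K'.Preconnected) :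
    range f = range g ∨ Disjoint (range f) (range g) := by
  by_cases h : Disjoint (range f) (range g)
  · exact Or.inr h
  · obtain ⟨v, hv, hv'⟩ := not_disjoint_iff.1 h
    exact Or.inl ((hf.range_eq_supp_of_mem hK hv).trans (hg.range_eq_supp_of_mem hK' hv').symm)

lemma IsTile.disjoint_of_isolate {κ' : Type*} {K' : SimpleGraph κ'} {g : κ' → V} {R : Set V}
    (hg : IsTile K' (isolate H R) g) (hK' : ∀ t, ∃ s, K'.Adj t s) : Disjoint (range g) R := by
  rw [Set.disjoint_left]
  rintro _ ⟨t, rfl⟩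
  obtain ⟨s, hs⟩ := hK' t
  exact (hg.adj_iff.2 hs).2.1

/-- Since `K'` has no isolated vertex, the tile avoids the vertices isolated by the deletion. -/
lemma IsTile.of_isolate {κ' : Type*} {K' : SimpleGraph κ'} {g : κ' → V}
    (hf : IsTile K H f) (hg : IsTile K' (isolate H (range f)) g) (hK' : ∀ t, ∃ s, K'.Adj t s) :
    IsTile K' H g := by
  have hd := hg.disjoint_of_isolate hK'
  refine ⟨hg.1, fun t w => ?_⟩
  rw [← hg.2]
  have ht : g t ∉ range f := hd.notMem_of_mem_left (mem_range_self t)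
  refine ⟨fun h => ⟨h, ht, fun hw => ht (hf.mem_range_of_adj hw h.symm)⟩, fun h => h.1⟩

lemma exists_adj_top_two : ∀ t : Fin 2, ∃ s, (⊤ : SimpleGraph (Fin 2)).Adj t s := fun t =>
  ⟨t + 1, by fin_cases t <;> simp⟩

lemma cycleGraph_six_adj {s t : Fin 6} : (cycleGraph 6).Adj s t ↔ t = s + 1 ∨ t = s - 1 := by
  rw [cycleGraph_adj]
  revert s t
  decide

lemma exists_adj_cycleGraph_six : ∀ t : Fin 6, ∃ s, (cycleGraph 6).Adj t s := fun t =>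
  ⟨t + 1, cycleGraph_six_adj.2 (Or.inl rfl)⟩

lemma IsTile.sextetSets_isolate (hf : IsTile K H f) (hK : K.Connected) :
    sextetSets (isolate H (range f)) = sextetSets H \ {range f} := by
  ext T
  constructor
  · rintro ⟨g, hg, rfl⟩
    refine ⟨⟨g, hf.of_isolate hg exists_adj_cycleGraph_six, rfl⟩, fun h => ?_⟩
    have hd := hg.disjoint_of_isolate exists_adj_cycleGraph_six
    rw [mem_singleton_iff] at h
    rw [← h, disjoint_self] at hd
    exact (range_nonempty g).ne_empty hd
  · rintro ⟨⟨g, hg, rfl⟩, h⟩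
    refine ⟨g, hg.isolate_of_disjoint ?_, rfl⟩
    exact (hg.eq_or_disjoint_range hf connected_cycleGraph_six.preconnected
      hK.preconnected).resolve_left h

lemma IsPartialClarCover.isolate {G : SimpleGraph V} {W : Set V} (hH : IsPartialClarCover G W H)
    (hf : IsTile K H f) (hK : K.Connected) :
    IsPartialClarCover G (W \ range f) (isolate H (range f)) := by
  refine ⟨fun a b h => hH.le h.1, fun h => ⟨hH.mem_of_adj h.1, h.2.1⟩, fun v hv => ?_⟩
  have aux : ∀ {n : ℕ} {K' : SimpleGraph (Fin n)} (_ : K'.Connected),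
      (∃ g, IsTile K' H g ∧ v ∈ range g) →
      ∃ g, IsTile K' (_root_.isolate H (range f)) g ∧ v ∈ range g := by
    rintro n K' hK' ⟨g, hg, hvg⟩
    refine ⟨g, hg.isolate_of_disjoint ?_, hvg⟩
    exact (hg.eq_or_disjoint_range hf hK'.preconnected hK.preconnected).resolve_left
      fun h => hv.2 (h ▸ hvg)
  exact (hH.exists_tile v hv.1).imp (aux connected_top_two) (aux connected_cycleGraph_six)

lemma map_adj_of_injective (hf : Function.Injective f) {u v : V} :
    (K.map f).Adj u v ↔ ∃ s t, K.Adj s t ∧ f s = u ∧ f t = v :=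
  map_adj ⟨f, hf⟩ K u v

lemma isTile_sup_map (hf : Function.Injective f) (hH : ∀ t w, ¬ H.Adj (f t) w) :
    IsTile K (H ⊔ K.map f) f := by
  refine ⟨hf, fun t w => ?_⟩
  simp only [sup_adj, map_adj_of_injective hf, hH, false_or]
  constructor
  · rintro ⟨a, b, hab, ha, rfl⟩
    exact ⟨b, hf ha ▸ hab, rfl⟩
  · rintro ⟨s, hs, rfl⟩
    exact ⟨t, s, hs, rfl, rfl⟩

lemma isolate_sup_map (hf : Function.Injective f) (hH : ∀ t w, ¬ H.Adj (f t) w) :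
    isolate (H ⊔ K.map f) (range f) = H := by
  ext a b
  constructor
  · rintro ⟨h | h, ha, -⟩
    · exact h
    · obtain ⟨s, t, -, rfl, -⟩ := (map_adj_of_injective hf).1 h
      exact absurd (mem_range_self s) ha
  · intro h
    refine ⟨Or.inl h, ?_, ?_⟩
    · rintro ⟨t, rfl⟩
      exact hH t b h
    · rintro ⟨t, rfl⟩
      exact hH t a h.symm

lemma IsTile.isolate_sup_map_self (h : IsTile K H f) :
    isolate H (range f) ⊔ K.map f = H := by
  ext a b
  constructor
  · rintro (hab | hab)
    · exact hab.1
    · obtain ⟨s, t, hst, rfl, rfl⟩ := (map_adj_of_injective h.1).1 hab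
      exact h.adj_iff.2 hst
  · intro hab
    by_cases ha : a ∈ range f
    · obtain ⟨t, rfl⟩ := ha
      obtain ⟨s, hs, rfl⟩ := (h.2 t b).1 hab
      exact Or.inr ((map_adj_of_injective h.1).2 ⟨t, s, hs, rfl, rfl⟩)
    · exact Or.inl ⟨hab, ha, fun hb => ha (h.mem_range_of_adj hb hab.symm)⟩

/-- Whether `v` lies in a double bond or in a hexagon of `H`. -/
def TileAt (H : SimpleGraph V) (v : V) : Prop :=
  (∃ f, IsTile (⊤ : SimpleGraph (Fin 2)) H f ∧ v ∈ range f) ∨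
    ∃ f, IsTile (cycleGraph 6) H f ∧ v ∈ range f

lemma IsPartialClarCover.sup_map {G : SimpleGraph V} {W : Set V} (hf : Function.Injective f)
    (hH : IsPartialClarCover G (W \ range f) H) (hfW : range f ⊆ W)
    (hfG : ∀ s t, K.Adj s t → G.Adj (f s) (f t))
    (ht : ∀ H' : SimpleGraph V, IsTile K H' f → ∀ t, TileAt H' (f t)) :
    IsPartialClarCover G W (H ⊔ K.map f) := by
  have hn : ∀ t w, ¬ H.Adj (f t) w := fun t w h => (hH.mem_of_adj h).2 (mem_range_self t)
  have hT := isTile_sup_map (K := K) hf hn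
  refine ⟨sup_le hH.le ?_, ?_, fun v hv => ?_⟩
  · intro a b h
    obtain ⟨s, t, hst, rfl, rfl⟩ := (map_adj_of_injective hf).1 h
    exact hfG s t hst
  · rintro a b (h | h)
    · exact (hH.mem_of_adj h).1
    · obtain ⟨s, t, hst, rfl, rfl⟩ := (map_adj_of_injective hf).1 h
      exact hfW (mem_range_self s)
  · by_cases hvf : v ∈ range f
    · obtain ⟨t, rfl⟩ := hvf
      exact ht _ hT t
    · have h := hH.exists_tile v ⟨hv, hvf⟩
      rw [← isolate_sup_map (K := K) hf hn] at h
      exact h.imp (fun ⟨g, hg, hvg⟩ => ⟨g, hT.of_isolate hg exists_adj_top_two, hvg⟩)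
        (fun ⟨g, hg, hvg⟩ => ⟨g, hT.of_isolate hg exists_adj_cycleGraph_six, hvg⟩)

/-- A bond of `H` at `u` is the tile `![u, a]`, for `a` the unique neighbour of `u`. -/
lemma IsTile.exists_bond {H : SimpleGraph V} {f : Fin 2 → V} (h : IsTile ⊤ H f) {u : V}
    (hu : u ∈ range f) : ∃ a, H.Adj u a ∧ IsTile (⊤ : SimpleGraph (Fin 2)) H ![u, a] := by
  obtain ⟨t, rfl⟩ := hu
  refine ⟨f (t + 1), h.adj_iff.2 (by fin_cases t <;> simp), ?_⟩
  have := h.comp_iso (K := ⊤) ⟨Equiv.addLeft t, by simp⟩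
  convert this using 1
  ext s
  fin_cases s <;> simp

/-- Rotations of the hexagon. -/
def cycleGraphSixRotate (t : Fin 6) : cycleGraph 6 ≃g cycleGraph 6 :=
  ⟨Equiv.addLeft t, by
    intro a b
    simp only [cycleGraph_six_adj, Equiv.coe_addLeft]
    revert a b t
    decide⟩

/-- The reflection of the hexagon fixing the vertex `0`. -/
def cycleGraphSixReflect : cycleGraph 6 ≃g cycleGraph 6 :=
  ⟨Equiv.neg (Fin 6), by
    intro a b
    simp only [cycleGraph_six_adj, Equiv.neg_apply]
    revert a b
    decide⟩

lemma IsTile.rotate {H : SimpleGraph V} {f : Fin 6 → V} (h : IsTile (cycleGraph 6) H f) {u : V}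
    (hu : u ∈ range f) : ∃ g, IsTile (cycleGraph 6) H g ∧ g 0 = u := by
  obtain ⟨t, rfl⟩ := hu
  exact ⟨_, h.comp_iso (cycleGraphSixRotate t), by simp [cycleGraphSixRotate]⟩

lemma IsTile.hexagon_adj {H : SimpleGraph V} {f : Fin 6 → V} (h : IsTile (cycleGraph 6) H f)
    (t : Fin 6) : H.Adj (f t) (f (t + 1)) :=
  h.adj_iff.2 (cycleGraph_six_adj.2 (Or.inl rfl))

variable [Finite V]

open Classical in
/-- Partial Clar covers containing a prescribed tile. -/
lemma sum_filter_isTile {G : SimpleGraph V} {W : Set V} (hf : Function.Injective f)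
    (hK : K.Connected) (hfW : range f ⊆ W) (hfG : ∀ s t, K.Adj s t → G.Adj (f s) (f t))
    (ht : ∀ H' : SimpleGraph V, IsTile K H' f → ∀ t, TileAt H' (f t)) (e : ℕ)
    (he : ∀ H' : SimpleGraph V, IsTile K H' f →
      (sextetSets H').ncard = e + (sextetSets H' \ {range f}).ncard) :
    ∑ H ∈ (partialClarCovers G W).filter (fun H => IsTile K H f), X ^ (sextetSets H).ncard =
      (X ^ e * coverPoly G (W \ range f) : ℤ[X]) := by
  rw [coverPoly, Finset.mul_sum]
  have hn : ∀ H ∈ partialClarCovers G (W \ range f), ∀ t w, ¬ H.Adj (f t) w :=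
    fun H hH t w h => ((mem_partialClarCovers.1 hH).mem_of_adj h).2 (mem_range_self t)
  refine Finset.sum_nbij' (fun H => isolate H (range f)) (fun H => H ⊔ K.map f) ?_ ?_ ?_ ?_ ?_
  · intro H hH
    rw [Finset.mem_filter, mem_partialClarCovers] at hH
    exact mem_partialClarCovers.2 (hH.1.isolate hH.2 hK)
  · intro H hH
    rw [Finset.mem_filter, mem_partialClarCovers]
    exact ⟨(mem_partialClarCovers.1 hH).sup_map hf hfW hfG ht, isTile_sup_map hf (hn H hH)⟩
  · intro H hH
    exact (Finset.mem_filter.1 hH).2.isolate_sup_map_self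
  · intro H hH
    exact isolate_sup_map hf (hn H hH)
  · intro H hH
    have hT := (Finset.mem_filter.1 hH).2
    rw [hT.sextetSets_isolate hK, he H hT, pow_add]

open Classical in
lemma sum_filter_bond {G : SimpleGraph V} {W : Set V} {u a : V} (hu : u ∈ W) (ha : a ∈ W)
    (hua : G.Adj u a) :
    ∑ H ∈ (partialClarCovers G W).filter (fun H => IsTile (⊤ : SimpleGraph (Fin 2)) H ![u, a]),
      X ^ (sextetSets H).ncard = coverPoly G (W \ {u, a}) := by
  have hr : range ![u, a] = {u, a} := by simp [pair_comm]
  have hinj : Function.Injective ![u, a] := by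
    intro s t
    fin_cases s <;> fin_cases t <;> simp [hua.ne, hua.ne']
  rw [sum_filter_isTile hinj connected_top_two (e := 0), hr]
  · simp
  · rw [hr]
    rintro _ (rfl | rfl) <;> assumption
  · intro s t
    fin_cases s <;> fin_cases t <;> simp [hua, hua.symm]
  · exact fun H' h t => Or.inl ⟨_, h, mem_range_self t⟩
  · intro H' _
    rw [zero_add, sdiff_singleton_eq_self]
    rintro ⟨g, hg, hgr⟩
    have h1 : (range g).ncard = 6 := by rw [ncard_range_of_injective hg.1]; simp
    rw [hgr, hr, ncard_pair hua.ne] at h1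
    omega

open Classical in
lemma sum_filter_hexagon {G : SimpleGraph V} {W : Set V} {f : Fin 6 → V}
    (hf : Function.Injective f) (hfW : ∀ t, f t ∈ W) (hfG : ∀ t, G.Adj (f t) (f (t + 1))) :
    ∑ H ∈ (partialClarCovers G W).filter (fun H => IsTile (cycleGraph 6) H f),
      X ^ (sextetSets H).ncard = X * coverPoly G (W \ range f) := by
  rw [sum_filter_isTile hf connected_cycleGraph_six (e := 1), pow_one]
  · rintro _ ⟨t, rfl⟩
    exact hfW t
  · intro s t hst
    rcases cycleGraph_six_adj.1 hst with rfl | rfl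
    · exact hfG s
    · simpa using (hfG (s - 1)).symm
  · exact fun H' h t => Or.inr ⟨_, h, mem_range_self t⟩
  · intro H' h
    rw [add_comm, ncard_sdiff_singleton_add_one (s := sextetSets H') ⟨f, h, rfl⟩]

lemma coverPoly_empty (G : SimpleGraph V) : coverPoly G ∅ = 1 := by
  have h : partialClarCovers G ∅ = {⊥} := by
    ext H
    rw [mem_partialClarCovers, Finset.mem_singleton]
    constructor
    · intro h
      ext a b
      simp only [bot_adj, iff_false]
      exact fun hab => h.mem_of_adj hab
    · rintro rfl
      exact ⟨bot_le, fun h => h.elim, fun v hv => hv.elim⟩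
  have h' : sextetSets (⊥ : SimpleGraph V) = ∅ := by
    refine eq_empty_of_forall_notMem ?_
    rintro _ ⟨f, hf, -⟩
    exact hf.adj_iff.2 (cycleGraph_six_adj.2 (Or.inl rfl) : (cycleGraph 6).Adj 0 (0 + 1))
  rw [coverPoly, h, Finset.sum_singleton, h']
  simp

/-- A vertex with a unique neighbour in `W` lies in a double bond. -/
lemma coverPoly_of_unique_neighbor {G : SimpleGraph V} {W : Set V} {u a : V} (hu : u ∈ W)
    (ha : a ∈ W) (hua : G.Adj u a) (hun : ∀ w ∈ W, G.Adj u w → w = a) :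
    coverPoly G W = coverPoly G (W \ {u, a}) := by
  classical
  rw [← sum_filter_bond hu ha hua, coverPoly, Finset.filter_true_of_mem]
  intro H hH
  have hH := mem_partialClarCovers.1 hH
  have key : ∀ w, H.Adj u w → w = a := fun w hw => hun w (hH.mem_of_adj hw.symm) (hH.le hw)
  rcases hH.exists_tile u hu with ⟨f, hf, huf⟩ | ⟨f, hf, huf⟩
  · obtain ⟨b, hb, ht⟩ := hf.exists_bond huf
    rwa [← key b hb]
  · obtain ⟨g, hg, rfl⟩ := hf.rotate huf
    have h1 := key _ (hg.hexagon_adj 0)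
    have h2 := key (g 5) (hg.hexagon_adj 5).symm
    exact absurd (hg.1 (h1.trans h2.symm)) (by decide)

/-- A vertex with exactly two neighbours in `W` that lies in exactly one hexagon through them. -/
lemma coverPoly_of_two_neighbors {G : SimpleGraph V} {W : Set V} {f : Fin 6 → V}
    (hf : Function.Injective f) (hfW : ∀ t, f t ∈ W) (hfG : ∀ t, G.Adj (f t) (f (t + 1)))
    (hnb : ∀ w ∈ W, G.Adj (f 0) w → w = f 1 ∨ w = f 5)
    (huniq : ∀ x y z, G.Adj (f 1) x → G.Adj x y → G.Adj y z → G.Adj z (f 5) →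
      x ≠ f 0 → y ≠ f 1 → z ≠ f 0 → x = f 2 ∧ y = f 3 ∧ z = f 4) :
    coverPoly G W = coverPoly G (W \ {f 0, f 1}) + coverPoly G (W \ {f 0, f 5}) +
      X * coverPoly G (W \ range f) := by
  classical
  have h15 : f 1 ≠ f 5 := fun h => absurd (hf h) (by decide)
  rw [← sum_filter_bond (hfW 0) (hfW 1) (hfG 0), ← sum_filter_bond (hfW 0) (hfW 5) (hfG 5).symm,
    ← sum_filter_hexagon hf hfW hfG]
  have bond_nb : ∀ {H : SimpleGraph V} {u a w : V}, IsTile (⊤ : SimpleGraph (Fin 2)) H ![u, a] →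
      H.Adj u w → w = a := by
    intro H u a w h hw
    obtain ⟨s, hs, rfl⟩ := (h.2 0 w).1 hw
    fin_cases s
    · exact absurd hs (SimpleGraph.irrefl _)
    · rfl
  -- The three sums sort the covers by the component of `f 0`; what remains is that these cases are
  -- exhaustive and disjoint.
  rw [← Finset.sum_union, ← Finset.sum_union, coverPoly]
  · refine Finset.sum_congr ?_ fun _ _ => rfl
    ext H
    simp only [Finset.mem_union, Finset.mem_filter, ← and_or_left]
    refine ⟨fun hH => ⟨hH, ?_⟩, And.left⟩
    have hH := mem_partialClarCovers.1 hH
    have key : ∀ w, H.Adj (f 0) w → w = f 1 ∨ w = f 5 :=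
      fun w hw => hnb w (hH.mem_of_adj hw.symm) (hH.le hw)
    rcases hH.exists_tile (f 0) (hfW 0) with ⟨g, hg, hu⟩ | ⟨g, hg, hu⟩
    · obtain ⟨b, hb, ht⟩ := hg.exists_bond hu
      left
      rcases key b hb with rfl | rfl
      · exact Or.inl ht
      · exact Or.inr ht
    · right
      have : ∃ g, IsTile (cycleGraph 6) H g ∧ g 0 = f 0 ∧ g 1 = f 1 ∧ g 5 = f 5 := by
        obtain ⟨g, hg, h0⟩ := hg.rotate hu
        have h1 := key (g 1) (h0 ▸ hg.hexagon_adj 0)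
        have h5 := key (g 5) (h0 ▸ (hg.hexagon_adj 5).symm)
        have hne : g 1 ≠ g 5 := fun h => absurd (hg.1 h) (by decide)
        rcases h1 with h1 | h1
        · exact ⟨g, hg, h0, h1, h5.resolve_left fun h => hne (h1.trans h.symm)⟩
        -- The labelling runs the wrong way round; reflecting it fixes `g 0` and swaps `g 1` with `g
        -- 5`.
        · refine ⟨_, hg.comp_iso cycleGraphSixReflect, h0, ?_, h1⟩
          exact h5.resolve_right fun h => hne (h1.trans h.symm)
      obtain ⟨g, hg, h0, h1, h5⟩ := this
      have hadj := fun t => hH.le (hg.hexagon_adj t)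
      have hne : ∀ s t, s ≠ t → g s ≠ g t := fun s t h h' => h (hg.1 h')
      obtain ⟨h2, h3, h4⟩ := huniq (g 2) (g 3) (g 4) (h1 ▸ hadj 1) (hadj 2) (hadj 3) (h5 ▸ hadj 4)
        (h0 ▸ hne 2 0 (by decide)) (h1 ▸ hne 3 1 (by decide)) (h0 ▸ hne 4 0 (by decide))
      have : g = f := by
        funext t
        fin_cases t <;> assumption
      exact this ▸ hg
  · rw [Finset.disjoint_left]
    intro H hH hH'
    have hg := (Finset.mem_filter.1 hH').2
    have a1 := hg.hexagon_adj 0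
    have a5 := (hg.hexagon_adj 5).symm
    rcases Finset.mem_union.1 hH with h | h
    · exact h15 (bond_nb (Finset.mem_filter.1 h).2 a5).symm
    · exact h15 (bond_nb (Finset.mem_filter.1 h).2 a1)
  · rw [Finset.disjoint_left]
    intro H hH hH'
    have h := (Finset.mem_filter.1 hH').2
    exact h15 (bond_nb (Finset.mem_filter.1 hH).2 (h.adj_iff (s := 0) (t := 1) |>.2 (by simp))).symm

end TileSurgery

/-! ### Delannoy polynomials -/

section Delannoy

/-- Generating polynomial of the lattice paths from `(0, 0)` to `(m, n)` with steps `(1, 0)`,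
`(0, 1)` and `(1, 1)`, by the number of diagonal steps. -/
def delannoy : ℕ → ℕ → ℤ[X]
  | 0, _ => 1
  | _ + 1, 0 => 1
  | m + 1, n + 1 => delannoy m (n + 1) + delannoy (m + 1) n + X * delannoy m n

@[simp] lemma delannoy_zero_left (n : ℕ) : delannoy 0 n = 1 := by rw [delannoy]

@[simp] lemma delannoy_zero_right (m : ℕ) : delannoy m 0 = 1 := by cases m <;> rw [delannoy]

lemma delannoy_succ_succ (m n : ℕ) :
    delannoy (m + 1) (n + 1) = delannoy m (n + 1) + delannoy (m + 1) n + X * delannoy m n := by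
  rw [delannoy]

/-- Induction with `X = (1 + X) - 1` and Pascal's rule in both binomials. The bound `B` is free
because terms beyond the minimum vanish, which lets the sums be taken over matching ranges. -/
lemma delannoy_eq_sum_range (m n B : ℕ) (hB : min m n ≤ B) :
    delannoy m n =
      ∑ j ∈ Finset.range (B + 1), (m.choose j * n.choose j : ℤ[X]) * (1 + X) ^ j := by
  induction m generalizing n B with
  | zero =>
    rw [Finset.sum_range_succ']
    simp
  | succ m ihm =>
    induction n generalizing B with
    | zero =>
      rw [Finset.sum_range_succ']
      simp
    | succ n ihn =>
      obtain ⟨B, rfl⟩ : ∃ B', B = B' + 1 := ⟨B - 1, by omega⟩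
      rw [delannoy_succ_succ, ihm (n + 1) (B + 1) (by omega), ihn (B + 1) (by omega)]
      have h1 := ihm n (B + 1) (by omega)
      have h2 := ihm n B (by omega)
      have h3 : X * delannoy m n = (1 + X) * delannoy m n - delannoy m n := by ring
      rw [h3]
      -- The copy multiplied by `1 + X` gets the shorter range, so that its powers line up with the
      -- shifted sums.
      nth_rw 1 [h2]
      rw [h1]
      simp only [Finset.sum_range_succ' _ (B + 1), Finset.mul_sum]
      simp only [Nat.choose_zero_right, Nat.choose_succ_succ, Nat.cast_add, Nat.cast_one, pow_zero,
        mul_one]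
      rw [← sub_eq_zero]
      have : ∀ a b c d e : ℤ[X], a + 1 + (b + 1) + (c - (d + 1)) - (e + 1) = a + b + c - d - e := by
        intros; ring
      rw [this, ← Finset.sum_add_distrib, ← Finset.sum_add_distrib, ← Finset.sum_sub_distrib,
        ← Finset.sum_sub_distrib]
      refine Finset.sum_eq_zero fun j _ => ?_
      ring

lemma delannoy_eq_sum (m n : ℕ) :
    delannoy m n =
      ∑ j ∈ Finset.Icc 0 (min m n), (m.choose j * n.choose j : ℤ[X]) * (1 + X) ^ j := by
  rw [delannoy_eq_sum_range m n _ le_rfl, Finset.range_eq_Ico]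
  rfl

lemma ascPochhammer_eval_neg_natCast (m j : ℕ) :
    (ascPochhammer ℂ j).eval (-(m : ℂ)) = (-1) ^ j * (j.factorial * m.choose j) := by
  rw [ascPochhammer_eval_neg_eq_descPochhammer, descPochhammer_eval_eq_descFactorial,
    Nat.descFactorial_eq_factorial_mul_choose]
  push_cast
  ring

/-- The series terminates since the binomials vanish. In each term the two signs `(-1) ^ j` cancel,
as do the two factorials against `j!` and the Pochhammer symbol of `1`. -/
lemma aeval_delannoy (m n : ℕ) (x : ℂ) :
    aeval x (delannoy m n) = ₂F₁ (-m : ℂ) (-n : ℂ) (1 : ℂ) (1 + x) := by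
  rw [ordinaryHypergeometric_eq_tsum, delannoy_eq_sum_range m n _ le_rfl]
  simp only [ascPochhammer_eval_neg_natCast, ascPochhammer_eval_one]
  rw [tsum_eq_sum (s := Finset.range (min m n + 1)), map_sum]
  · refine Finset.sum_congr rfl fun j _ => ?_
    have h : (j.factorial : ℂ) ≠ 0 := by exact_mod_cast j.factorial_ne_zero
    have h2 : ((-1 : ℂ) ^ j) * (-1) ^ j = 1 := by rw [← mul_pow]; simp
    simp only [map_mul, map_natCast, map_pow, map_add, map_one, aeval_X, smul_eq_mul]
    field_simp
    linear_combination (-(m.choose j : ℂ) * n.choose j * (1 + x) ^ j) * h2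
  · intro j hj
    rw [Finset.mem_range] at hj
    rcases (by omega : m < j ∨ n < j) with h | h <;> simp [Nat.choose_eq_zero_of_lt h]

/-- Delannoy polynomials extended by zero to integer arguments. -/
def delannoyInt (a b : ℤ) : ℤ[X] :=
  if 0 ≤ a ∧ 0 ≤ b then delannoy a.toNat b.toNat else 0

lemma delannoyInt_natCast (m n : ℕ) : delannoyInt m n = delannoy m n := by
  simp [delannoyInt]

lemma delannoyInt_eq_zero {a b : ℤ} (h : a < 0 ∨ b < 0) : delannoyInt a b = 0 :=
  if_neg (by omega)

lemma delannoyInt_zero_zero : delannoyInt 0 0 = 1 := by simp [delannoyInt]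

/-- Extension by zero absorbs the boundary cases: one recursion holds on the whole plane, with a
source term at the origin. -/
lemma delannoyInt_rec (a b : ℤ) :
    delannoyInt a b = delannoyInt (a - 1) b + delannoyInt a (b - 1) +
      X * delannoyInt (a - 1) (b - 1) + if a = 0 ∧ b = 0 then 1 else 0 := by
  by_cases h : a < 0 ∨ b < 0
  · rw [delannoyInt_eq_zero h, delannoyInt_eq_zero (by omega), delannoyInt_eq_zero (by omega),
      delannoyInt_eq_zero (by omega), if_neg (by omega)]
    simp
  · obtain ⟨m, rfl⟩ := Int.eq_ofNat_of_zero_le (show 0 ≤ a by omega)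
    obtain ⟨n, rfl⟩ := Int.eq_ofNat_of_zero_le (show 0 ≤ b by omega)
    rcases m with _ | m
    · rw [delannoyInt_eq_zero (a := _ - 1) (by simp), delannoyInt_eq_zero (a := _ - 1) (by simp)]
      rcases n with _ | n
      · rw [delannoyInt_eq_zero (b := _ - 1) (by simp)]
        simp [delannoyInt_zero_zero]
      · rw [show ((n + 1 : ℕ) : ℤ) - 1 = n by simp, delannoyInt_natCast, delannoyInt_natCast,
          if_neg (by omega)]
        simp
    · rcases n with _ | n
      · rw [delannoyInt_eq_zero (b := _ - 1) (by simp), delannoyInt_eq_zero (b := _ - 1) (by simp),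
          show ((m + 1 : ℕ) : ℤ) - 1 = m by simp, delannoyInt_natCast, delannoyInt_natCast,
          if_neg (by omega)]
        simp
      · rw [show ((n + 1 : ℕ) : ℤ) - 1 = n by simp, show ((m + 1 : ℕ) : ℤ) - 1 = m by simp,
          delannoyInt_natCast, delannoyInt_natCast, delannoyInt_natCast, delannoyInt_natCast,
          if_neg (by omega), delannoy_succ_succ]
        simp

end Delannoy

/-! ### Lattice paths in an L-shaped region -/

section PathSum

variable (n₁ n₂ m₁ m₂ : ℕ)

/-- Paths from `(i, j)` to `(n₁ + n₂, m₁ + m₂)`, sorted by the point or diagonal step at which they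
cross the antidiagonal `i + j = n₂ + m₁`. -/
def crossingSum (i j : ℤ) : ℤ[X] :=
  ∑ k ∈ Finset.Icc 0 (min n₁ m₁),
    delannoyInt (m₁ - k - j) (n₂ + k - i) * delannoy (m₂ + k) (n₁ - k) +
  X * ∑ k ∈ Finset.Icc 1 (min n₁ m₁),
    delannoyInt (m₁ - k - j) (n₂ + k - 1 - i) * delannoy (m₂ + k - 1) (n₁ - k)

/-- The recursion is applied to the first factor of every summand. Before the antidiagonal the
source term never occurs in the first sum; in the second it occurs when the crossing diagonal step
starts at `(i, j)` itself, which is the extra sum. -/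
lemma crossingSum_rec {i j : ℤ} (h : i + j < n₂ + m₁) :
    crossingSum n₁ n₂ m₁ m₂ i j =
      crossingSum n₁ n₂ m₁ m₂ i (j + 1) + crossingSum n₁ n₂ m₁ m₂ (i + 1) j +
      X * (crossingSum n₁ n₂ m₁ m₂ (i + 1) (j + 1) + ∑ k ∈ Finset.Icc 1 (min n₁ m₁),
        if m₁ - k - j = 0 ∧ n₂ + k - 1 - i = 0 then delannoy (m₂ + k - 1) (n₁ - k) else 0) := by
  have e1 : ∀ k : ℕ, delannoyInt (m₁ - k - j) (n₂ + k - i) * delannoy (m₂ + k) (n₁ - k) =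
      delannoyInt (m₁ - k - (j + 1)) (n₂ + k - i) * delannoy (m₂ + k) (n₁ - k) +
      delannoyInt (m₁ - k - j) (n₂ + k - (i + 1)) * delannoy (m₂ + k) (n₁ - k) +
      X * (delannoyInt (m₁ - k - (j + 1)) (n₂ + k - (i + 1)) * delannoy (m₂ + k) (n₁ - k)) := by
    intro k
    rw [delannoyInt_rec, if_neg (by omega), sub_sub _ j, sub_sub _ i]
    ring
  have e2 : ∀ k : ℕ, delannoyInt (m₁ - k - j) (n₂ + k - 1 - i) * delannoy (m₂ + k - 1) (n₁ - k) =
      delannoyInt (m₁ - k - (j + 1)) (n₂ + k - 1 - i) * delannoy (m₂ + k - 1) (n₁ - k) +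
      delannoyInt (m₁ - k - j) (n₂ + k - 1 - (i + 1)) * delannoy (m₂ + k - 1) (n₁ - k) +
      X * (delannoyInt (m₁ - k - (j + 1)) (n₂ + k - 1 - (i + 1)) *
        delannoy (m₂ + k - 1) (n₁ - k)) +
      if m₁ - k - j = 0 ∧ n₂ + k - 1 - i = 0 then delannoy (m₂ + k - 1) (n₁ - k) else 0 := by
    intro k
    rw [delannoyInt_rec, sub_sub _ j, sub_sub _ i]
    split_ifs <;> ring
  simp only [crossingSum]
  rw [Finset.sum_congr rfl fun k _ => e1 k, Finset.sum_congr rfl fun k _ => e2 k]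
  simp only [Finset.sum_add_distrib, ← Finset.mul_sum]
  ring

lemma crossingSum_eq_zero {i j : ℤ} (h : n₁ + n₂ < i ∨ m₁ < j ∨ n₂ + m₁ < i + j) :
    crossingSum n₁ n₂ m₁ m₂ i j = 0 := by
  rw [crossingSum, Finset.sum_eq_zero, Finset.sum_eq_zero, mul_zero, add_zero]
  all_goals
    intro k hk
    rw [Finset.mem_Icc] at hk
    rw [delannoyInt_eq_zero (by omega), zero_mul]

/-- A start on the antidiagonal is its own crossing point, so only `k = m₁ - j` contributes. Hence
the two branches of `pathSum` agree there. -/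
lemma crossingSum_of_add_eq {i j : ℤ} (h : i + j = n₂ + m₁) (hi : i ≤ n₁ + n₂) (hj : 0 ≤ j)
    (hj' : j ≤ m₁) :
    crossingSum n₁ n₂ m₁ m₂ i j = delannoyInt (m₁ + m₂ - j) (n₁ + n₂ - i) := by
  obtain ⟨k, hk⟩ := Int.eq_ofNat_of_zero_le (show 0 ≤ m₁ - j by omega)
  rw [crossingSum, Finset.sum_eq_single k, Finset.sum_eq_zero, mul_zero, add_zero]
  · rw [show (m₁ - k - j : ℤ) = 0 by omega, show (n₂ + k - i : ℤ) = 0 by omega,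
      delannoyInt_zero_zero, one_mul, ← delannoyInt_natCast]
    congr 1 <;> omega
  · intro l _
    rw [delannoyInt_eq_zero (by omega), zero_mul]
  · intro l _ hl
    rw [delannoyInt_eq_zero (by omega), zero_mul]
  · intro hk'
    rw [Finset.mem_Icc] at hk'
    omega

/-- The weighted number of paths from `(i, j)` to `(n₁ + n₂, m₁ + m₂)` in the L-shaped region. -/
def pathSum (i j : ℤ) : ℤ[X] :=
  if n₂ + m₁ ≤ i + j then delannoyInt (m₁ + m₂ - j) (n₁ + n₂ - i) else crossingSum n₁ n₂ m₁ m₂ i j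

variable {n₁ n₂ m₁ m₂}

lemma pathSum_of_le {i j : ℤ} (h : n₂ + m₁ ≤ i + j) :
    pathSum n₁ n₂ m₁ m₂ i j = delannoyInt (m₁ + m₂ - j) (n₁ + n₂ - i) := if_pos h

lemma pathSum_eq_crossingSum {i j : ℤ} (h : i + j ≤ n₂ + m₁) (hi : i ≤ n₁ + n₂) (hj : 0 ≤ j)
    (hj' : j ≤ m₁) :
    pathSum n₁ n₂ m₁ m₂ i j = crossingSum n₁ n₂ m₁ m₂ i j := by
  rcases h.lt_or_eq with h | h
  · exact if_neg (by omega)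
  · rw [pathSum_of_le h.ge, crossingSum_of_add_eq _ _ _ _ h hi hj hj']

lemma pathSum_end : pathSum n₁ n₂ m₁ m₂ (n₁ + n₂) (m₁ + m₂) = 1 := by
  rw [pathSum_of_le (by omega), sub_self, sub_self, delannoyInt_zero_zero]

lemma pathSum_of_last_row {j : ℤ} (hj : 0 ≤ j) (hj' : j < m₁ + m₂) :
    pathSum n₁ n₂ m₁ m₂ (n₁ + n₂) j = pathSum n₁ n₂ m₁ m₂ (n₁ + n₂) (j + 1) := by
  by_cases h : (n₂ + m₁ : ℤ) ≤ n₁ + n₂ + j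
  · rw [pathSum_of_le h, pathSum_of_le (by omega), delannoyInt_rec, if_neg (by omega),
      delannoyInt_eq_zero (b := _ - 1) (by omega), delannoyInt_eq_zero (b := _ - 1) (by omega)]
    simp [sub_sub]
  · rw [pathSum_eq_crossingSum (by omega) le_rfl hj (by omega),
      pathSum_eq_crossingSum (by omega) le_rfl (by omega) (by omega),
      crossingSum_rec _ _ _ _ (by omega), crossingSum_eq_zero (i := _ + 1) (j := j) _ _ _ _ (by omega),
      crossingSum_eq_zero (i := _ + 1) _ _ _ _ (by omega), Finset.sum_eq_zero]
    · simp
    · intro k hk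
      rw [Finset.mem_Icc] at hk
      exact if_neg (by omega)

lemma pathSum_of_last_column {i j : ℤ} (hi : i < n₁ + n₂)
    (hj : j = m₁ + m₂ ∧ n₂ ≤ i ∨ j = m₁ ∧ i < n₂) :
    pathSum n₁ n₂ m₁ m₂ i j = pathSum n₁ n₂ m₁ m₂ (i + 1) j := by
  by_cases h : n₂ + m₁ ≤ i + j
  · rw [pathSum_of_le h, pathSum_of_le (by omega), delannoyInt_rec, if_neg (by omega),
      delannoyInt_eq_zero (a := _ - 1) (by omega), delannoyInt_eq_zero (a := _ - 1) (by omega)]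
    simp [sub_sub]
  · rw [pathSum_eq_crossingSum (by omega) (by omega) (by omega) (by omega),
      pathSum_eq_crossingSum (by omega) (by omega) (by omega) (by omega),
      crossingSum_rec _ _ _ _ (by omega), crossingSum_eq_zero (i := i) (j := _ + 1) _ _ _ _ (by omega),
      crossingSum_eq_zero (j := _ + 1) _ _ _ _ (by omega), Finset.sum_eq_zero]
    · simp
    · intro k hk
      rw [Finset.mem_Icc] at hk
      exact if_neg (by omega)

/-- This is the Delannoy recursion on either side of the antidiagonal; the delicate case is a
diagonal step that jumps over it. -/
lemma pathSum_of_cell {i j : ℤ} (hi : i < n₁ + n₂) (hj : 0 ≤ j)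
    (hj' : j < m₁ ∨ n₂ ≤ i ∧ j < m₁ + m₂) :
    pathSum n₁ n₂ m₁ m₂ i j = pathSum n₁ n₂ m₁ m₂ i (j + 1) + pathSum n₁ n₂ m₁ m₂ (i + 1) j +
      X * pathSum n₁ n₂ m₁ m₂ (i + 1) (j + 1) := by
  rcases lt_trichotomy (i + j + 1) (n₂ + m₁) with h | h | h
  · rw [pathSum_eq_crossingSum (by omega) (by omega) (by omega) (by omega),
      pathSum_eq_crossingSum (by omega) (by omega) (by omega) (by omega),
      pathSum_eq_crossingSum (by omega) (by omega) (by omega) (by omega),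
      pathSum_eq_crossingSum (by omega) (by omega) (by omega) (by omega),
      crossingSum_rec _ _ _ _ (by omega), Finset.sum_eq_zero, add_zero]
    intro k hk
    rw [Finset.mem_Icc] at hk
    exact if_neg (by omega)
  -- Here `(i + 1, j + 1)` lies beyond the antidiagonal, where `crossingSum` vanishes; the extra
  -- term of `crossingSum_rec` with `k = m₁ - j` supplies the missing value.
  · obtain ⟨k, hk⟩ := Int.eq_ofNat_of_zero_le (show 0 ≤ m₁ - j by omega)
    rw [pathSum_eq_crossingSum (by omega) (by omega) (by omega) (by omega),
      pathSum_eq_crossingSum (by omega) (by omega) (by omega) (by omega),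
      pathSum_eq_crossingSum (by omega) (by omega) (by omega) (by omega),
      pathSum_of_le (by omega),
      crossingSum_rec _ _ _ _ (by omega), Finset.sum_eq_single k,
      crossingSum_eq_zero (i := i + 1) (j := j + 1) _ _ _ _ (by omega), if_pos (by omega),
      ← delannoyInt_natCast, zero_add]
    · congr 3 <;> omega
    · intro l _ hl
      exact if_neg (by omega)
    · intro hk'
      rw [Finset.mem_Icc] at hk'
      omega
  · rw [pathSum_of_le (by omega), pathSum_of_le (by omega), pathSum_of_le (by omega),
      pathSum_of_le (by omega), delannoyInt_rec, if_neg (by omega), add_zero, sub_sub, sub_sub]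

end PathSum

/-! ### Vertices and edges of benzenoids -/

section Benzenoid

variable {S : Finset (ℤ × ℤ)}

lemma hexCorner_fst (c : ℤ × ℤ) (t : Fin 6) :
    (hexCorner c t).1 = c.2 - c.1 + ![0, 1, 1, 0, -1, -1] t := by
  fin_cases t <;> simp [hexCorner, hexOffset]

lemma hexCorner_snd (c : ℤ × ℤ) (t : Fin 6) :
    (hexCorner c t).2 = ![2, 1, -1, -2, -1, 1] t - 3 * (c.1 + c.2) := by
  fin_cases t <;> simp [hexCorner, hexOffset] <;> ring

lemma hexCorner_injective (c : ℤ × ℤ) : Function.Injective (hexCorner c) := by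
  intro s t h
  have h1 := congrArg Prod.fst h
  have h2 := congrArg Prod.snd h
  rw [hexCorner_fst, hexCorner_fst] at h1
  rw [hexCorner_snd, hexCorner_snd] at h2
  fin_cases s <;> fin_cases t <;> simp at h1 h2 ⊢

lemma mem_benzenoidVertices {p : ℤ × ℤ} :
    p ∈ benzenoidVertices S ↔ ∃ c ∈ S, ∃ t, hexCorner c t = p := by
  simp [benzenoidVertices]

lemma hexCorner_mem {c : ℤ × ℤ} (hc : c ∈ S) (t : Fin 6) : hexCorner c t ∈ benzenoidVertices S :=
  mem_benzenoidVertices.2 ⟨c, hc, t, rfl⟩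

lemma benzenoid_adj_of_corner {c : ℤ × ℤ} (hc : c ∈ S) {p q : benzenoidVertices S} (t : Fin 6)
    (hp : p.1 = hexCorner c t) (hq : q.1 = hexCorner c (t + 1)) : (benzenoid S).Adj p q := by
  refine (SimpleGraph.fromRel_adj _ _ _).2 ⟨fun h => ?_, Or.inl ⟨c, hc, t, hp, hq⟩⟩
  rw [h, hq] at hp
  have aux : ∀ t : Fin 6, t + 1 ≠ t := by decide
  exact aux t (hexCorner_injective c hp)

/-- A vertex is an upper corner (residue `2`) or a lower corner (residue `1`) of a cell. -/
lemma benzenoid_vertex_mod (p : benzenoidVertices S) : p.1.2 % 3 = 1 ∨ p.1.2 % 3 = 2 := by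
  obtain ⟨c, -, t, ht⟩ := mem_benzenoidVertices.1 p.2
  have h := hexCorner_snd c t
  rw [ht] at h
  fin_cases t <;> simp at h <;> omega

/-- Only necessary conditions on coordinates are kept, independent of `S`; they reduce later
neighbour arguments to linear arithmetic. -/
lemma benzenoid_adj_coords {p q : benzenoidVertices S} (h : (benzenoid S).Adj p q) :
    p.1.2 % 3 = 2 ∧ (q.1.1 = p.1.1 ∧ q.1.2 = p.1.2 + 2 ∨
      q.1.1 = p.1.1 + 1 ∧ q.1.2 = p.1.2 - 1 ∨ q.1.1 = p.1.1 - 1 ∧ q.1.2 = p.1.2 - 1) ∨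
    p.1.2 % 3 = 1 ∧ (q.1.1 = p.1.1 ∧ q.1.2 = p.1.2 - 2 ∨
      q.1.1 = p.1.1 + 1 ∧ q.1.2 = p.1.2 + 1 ∨ q.1.1 = p.1.1 - 1 ∧ q.1.2 = p.1.2 + 1) := by
  have key : ∀ (c : ℤ × ℤ) (t : Fin 6) (x y : ℤ × ℤ), x = hexCorner c t → y = hexCorner c (t + 1) →
      x.2 % 3 = 2 ∧ y.2 % 3 = 1 ∧ (y.1 = x.1 ∧ y.2 = x.2 + 2 ∨
      y.1 = x.1 + 1 ∧ y.2 = x.2 - 1 ∨ y.1 = x.1 - 1 ∧ y.2 = x.2 - 1) ∨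
      x.2 % 3 = 1 ∧ y.2 % 3 = 2 ∧ (y.1 = x.1 ∧ y.2 = x.2 - 2 ∨
      y.1 = x.1 + 1 ∧ y.2 = x.2 + 1 ∨ y.1 = x.1 - 1 ∧ y.2 = x.2 + 1) := by
    intro c t x y hx hy
    have h1 := hexCorner_fst c t
    have h2 := hexCorner_snd c t
    have h3 := hexCorner_fst c (t + 1)
    have h4 := hexCorner_snd c (t + 1)
    rw [← hx] at h1 h2
    rw [← hy] at h3 h4
    fin_cases t <;> simp [Fin.add_def] at h1 h2 h3 h4 <;> omega
  obtain ⟨-, ⟨c, -, t, hp, hq⟩ | ⟨c, -, t, hq, hp⟩⟩ := (SimpleGraph.fromRel_adj _ _ _).1 h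
  · have := key c t _ _ hp hq
    omega
  · have := key c t _ _ hq hp
    omega

/-- Two positions are left for each of `x` and `z`. Unless both are corners of the cell `(i, j)`,
they are too far apart to share a neighbour `y`. -/
lemma benzenoid_hexagon_unique {i j : ℤ} {a b x y z : benzenoidVertices S}
    (ha : a.1.1 = j - i + 1 ∧ a.1.2 = 1 - 3 * (i + j))
    (hb : b.1.1 = j - i - 1 ∧ b.1.2 = 1 - 3 * (i + j))
    (hax : (benzenoid S).Adj a x) (hxy : (benzenoid S).Adj x y) (hyz : (benzenoid S).Adj y z)
    (hzb : (benzenoid S).Adj z b) (hx : ¬ (x.1.1 = j - i ∧ x.1.2 = 2 - 3 * (i + j)))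
    (hy : ¬ (y.1.1 = j - i + 1 ∧ y.1.2 = 1 - 3 * (i + j)))
    (hz : ¬ (z.1.1 = j - i ∧ z.1.2 = 2 - 3 * (i + j))) :
    (x.1.1 = j - i + 1 ∧ x.1.2 = -1 - 3 * (i + j)) ∧
      (y.1.1 = j - i ∧ y.1.2 = -2 - 3 * (i + j)) ∧
      (z.1.1 = j - i - 1 ∧ z.1.2 = -1 - 3 * (i + j)) := by
  have h1 : x.1.1 = j - i + 1 ∧ x.1.2 = -1 - 3 * (i + j) ∨
      x.1.1 = j - i + 2 ∧ x.1.2 = 2 - 3 * (i + j) := by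
    have := benzenoid_adj_coords hax
    omega
  have h4 : z.1.1 = j - i - 1 ∧ z.1.2 = -1 - 3 * (i + j) ∨
      z.1.1 = j - i - 2 ∧ z.1.2 = 2 - 3 * (i + j) := by
    have := benzenoid_adj_coords hzb.symm
    omega
  have h2 := benzenoid_adj_coords hxy
  have h3 := benzenoid_adj_coords hyz.symm
  rcases h1 with h1 | h1 <;> rcases h4 with h4 | h4 <;> omega

end Benzenoid

/-! ### Peeling a path off a ribbon -/

section Ribbon

open Set

variable {S : Finset (ℤ × ℤ)}

/-- The set `W` of vertices that remain when the part of a Clar cover along a path has been removed,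
for a path from `(σ, 0)` that has arrived at the point `(i, j)`. -/
structure PathState (σ i j : ℤ) (W : Set (benzenoidVertices S)) : Prop where
  current_mem : ∀ p, p.1.1 = j - i → p.1.2 = 2 - 3 * (i + j) → p ∈ W
  current_notMem : ∀ p, p.1.1 = j - i → p.1.2 = 4 - 3 * (i + j) → p ∉ W
  pair : ∀ p q, q.1.1 = p.1.1 → q.1.2 = p.1.2 + 2 → p.1.2 % 3 = 2 →
    ¬ (p.1.1 = j - i ∧ p.1.2 = 2 - 3 * (i + j)) → (p ∈ W ↔ q ∈ W)
  below : ∀ p, p.1.2 < 2 - 3 * (i + j) → p ∈ W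
  source : ∀ p ∈ W, p.1.1 = -σ → p.1.2 = 2 - 3 * σ → i = σ ∧ j = 0

namespace PathState

variable {σ i j : ℤ} {W : Set (benzenoidVertices S)}

lemma vertex_ext_iff {p q : benzenoidVertices S} : p = q ↔ p.1.1 = q.1.1 ∧ p.1.2 = q.1.2 := by
  rw [Subtype.ext_iff, Prod.ext_iff]

/-- The vertex `a` is the upper end of the vertical edge at `(i, j + 1)`, whose lower end becomes
current. Removing `u` completes the removal of the edge at `(i, j)`, which restores the pairing
there. -/
lemma step_right (h : PathState σ i j W) {u a : benzenoidVertices S} (hu₁ : u.1.1 = j - i)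
    (hu₂ : u.1.2 = 2 - 3 * (i + j)) (ha₁ : a.1.1 = j - i + 1) (ha₂ : a.1.2 = 1 - 3 * (i + j)) :
    PathState σ i (j + 1) (W \ {u, a}) := by
  have hW : ∀ p, p ∈ W \ {u, a} ↔ p ∈ W ∧ ¬ (p.1.1 = j - i ∧ p.1.2 = 2 - 3 * (i + j)) ∧
      ¬ (p.1.1 = j - i + 1 ∧ p.1.2 = 1 - 3 * (i + j)) := by
    intro p
    simp only [mem_sdiff, mem_insert_iff, mem_singleton_iff, vertex_ext_iff, hu₁, hu₂, ha₁, ha₂,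
      not_or]
  constructor
  · intro p h1 h2
    exact (hW p).2 ⟨h.below p (by omega), by omega, by omega⟩
  · intro p h1 h2 hp
    have := ((hW p).1 hp).2
    omega
  · intro p q h1 h2 h3 h4
    rw [hW, hW]
    by_cases hc : p.1.1 = j - i ∧ p.1.2 = 2 - 3 * (i + j)
    · have := h.current_notMem q (by omega) (by omega)
      tauto
    · have := h.pair p q h1 h2 h3 hc
      constructor
      · exact fun hp => ⟨this.1 hp.1, by omega, by omega⟩
      · exact fun hp => ⟨this.2 hp.1, by omega, by omega⟩
  · intro p hp
    exact (hW p).2 ⟨h.below p (by omega), by omega, by omega⟩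
  · intro p hp h1 h2
    have hp := (hW p).1 hp
    have := h.source p hp.1 h1 h2
    omega

lemma step_left (h : PathState σ i j W) {u a : benzenoidVertices S} (hu₁ : u.1.1 = j - i)
    (hu₂ : u.1.2 = 2 - 3 * (i + j)) (ha₁ : a.1.1 = j - i - 1) (ha₂ : a.1.2 = 1 - 3 * (i + j)) :
    PathState σ (i + 1) j (W \ {u, a}) := by
  have hW : ∀ p, p ∈ W \ {u, a} ↔ p ∈ W ∧ ¬ (p.1.1 = j - i ∧ p.1.2 = 2 - 3 * (i + j)) ∧
      ¬ (p.1.1 = j - i - 1 ∧ p.1.2 = 1 - 3 * (i + j)) := by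
    intro p
    simp only [mem_sdiff, mem_insert_iff, mem_singleton_iff, vertex_ext_iff, hu₁, hu₂, ha₁, ha₂,
      not_or]
  constructor
  · intro p h1 h2
    exact (hW p).2 ⟨h.below p (by omega), by omega, by omega⟩
  · intro p h1 h2 hp
    have := ((hW p).1 hp).2
    omega
  · intro p q h1 h2 h3 h4
    rw [hW, hW]
    by_cases hc : p.1.1 = j - i ∧ p.1.2 = 2 - 3 * (i + j)
    · have := h.current_notMem q (by omega) (by omega)
      tauto
    · have := h.pair p q h1 h2 h3 hc
      constructor
      · exact fun hp => ⟨this.1 hp.1, by omega, by omega⟩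
      · exact fun hp => ⟨this.2 hp.1, by omega, by omega⟩
  · intro p hp
    exact (hW p).2 ⟨h.below p (by omega), by omega, by omega⟩
  · intro p hp h1 h2
    have hp := (hW p).1 hp
    have := h.source p hp.1 h1 h2
    omega

/-- Besides `u`, the hexagon uses up its two vertical sides entirely and the upper end of the
vertical edge at `(i + 1, j + 1)`. -/
lemma step_diagonal (h : PathState σ i j W) {f : Fin 6 → benzenoidVertices S}
    (hf : ∀ t, (f t).1 = hexCorner (i, j) t) : PathState σ (i + 1) (j + 1) (W \ range f) := by
  have hW : ∀ p, p ∈ W \ range f ↔ p ∈ W ∧ ¬ (p.1.1 = j - i ∧ p.1.2 = 2 - 3 * (i + j)) ∧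
      ¬ (p.1.1 = j - i + 1 ∧ p.1.2 = 1 - 3 * (i + j)) ∧
      ¬ (p.1.1 = j - i + 1 ∧ p.1.2 = -1 - 3 * (i + j)) ∧
      ¬ (p.1.1 = j - i ∧ p.1.2 = -2 - 3 * (i + j)) ∧
      ¬ (p.1.1 = j - i - 1 ∧ p.1.2 = -1 - 3 * (i + j)) ∧
      ¬ (p.1.1 = j - i - 1 ∧ p.1.2 = 1 - 3 * (i + j)) := by
    intro p
    simp only [mem_sdiff, mem_range, not_exists, @eq_comm _ _ p, vertex_ext_iff, hf, hexCorner_fst,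
      hexCorner_snd, Fin.forall_fin_succ]
    simp [← sub_eq_add_neg]
  constructor
  · intro p h1 h2
    exact (hW p).2 ⟨h.below p (by omega), by omega, by omega, by omega, by omega, by omega, by omega⟩
  · intro p h1 h2 hp
    have := ((hW p).1 hp).2
    omega
  · intro p q h1 h2 h3 h4
    rw [hW, hW]
    by_cases hc : p.1.1 = j - i ∧ p.1.2 = 2 - 3 * (i + j)
    · have := h.current_notMem q (by omega) (by omega)
      tauto
    · have := h.pair p q h1 h2 h3 hc
      constructor
      · exact fun hp => ⟨this.1 hp.1, by omega, by omega, by omega, by omega, by omega, by omega⟩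
      · exact fun hp => ⟨this.2 hp.1, by omega, by omega, by omega, by omega, by omega, by omega⟩
  · intro p hp
    exact (hW p).2 ⟨h.below p (by omega), by omega, by omega, by omega, by omega, by omega, by omega⟩
  · intro p hp h1 h2
    have hp := (hW p).1 hp
    have := h.source p hp.1 h1 h2
    omega

end PathState

open PathState

variable {σ : ℤ} {n₁ n₂ m₁ m₂ : ℕ}

lemma mem_ribbonCells {c : ℤ × ℤ} : c ∈ ribbonCells n₁ n₂ m₁ m₂ ↔
    0 ≤ c.1 ∧ c.1 < n₁ + n₂ ∧ 0 ≤ c.2 ∧ (c.2 < m₁ ∨ n₂ ≤ c.1 ∧ c.2 < m₁ + m₂) := by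
  simp only [ribbonCells, Finset.mem_union, Finset.mem_product, Finset.mem_Ico]
  omega

lemma ribbon_exists_above (hs : σ = 0 ∧ 1 ≤ m₁ ∨ σ = n₂ ∧ m₁ = 0)
    {p : benzenoidVertices (ribbonCells n₁ n₂ m₁ m₂)} (hp : p.1.2 % 3 = 2)
    (hp0 : ¬ (p.1.1 = -σ ∧ p.1.2 = 2 - 3 * σ)) :
    ∃ q, q.1.1 = p.1.1 ∧ q.1.2 = p.1.2 + 2 ∧ (ribbon n₁ n₂ m₁ m₂).Adj p q := by
  have key : ∀ c ∈ ribbonCells n₁ n₂ m₁ m₂, p.1 = hexCorner c 2 ∨ p.1 = hexCorner c 4 →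
      ∃ q, q.1.1 = p.1.1 ∧ q.1.2 = p.1.2 + 2 ∧ (ribbon n₁ n₂ m₁ m₂).Adj p q := by
    rintro c hc (h | h)
    · refine ⟨⟨_, hexCorner_mem hc 1⟩, ?_, ?_, (benzenoid_adj_of_corner hc 1 rfl h).symm⟩
      · rw [h, hexCorner_fst, hexCorner_fst]
        simp
      · rw [h, hexCorner_snd, hexCorner_snd]
        simp
        ring
    · refine ⟨⟨_, hexCorner_mem hc 5⟩, ?_, ?_, benzenoid_adj_of_corner hc 4 h rfl⟩
      · rw [h, hexCorner_fst, hexCorner_fst]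
        simp
      · rw [h, hexCorner_snd, hexCorner_snd]
        simp
        ring
  obtain ⟨c, hc, t, ht⟩ := mem_benzenoidVertices.1 p.2
  have h1 := hexCorner_fst c t
  have h2 := hexCorner_snd c t
  have hc' := mem_ribbonCells.1 hc
  rw [ht] at h1 h2
  fin_cases t
  · simp at h1 h2
    -- A top corner is a lower side corner of the cell to its upper left or upper right; only at the
    -- source are both cells missing.
    by_cases h0 : 1 ≤ c.2
    · refine key (c.1, c.2 - 1) (mem_ribbonCells.2 (by simp only; omega)) (Or.inl ?_)
      rw [Prod.ext_iff, hexCorner_fst, hexCorner_snd]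
      simp
      omega
    · refine key (c.1 - 1, c.2) (mem_ribbonCells.2 (by simp only; omega)) (Or.inr ?_)
      rw [Prod.ext_iff, hexCorner_fst, hexCorner_snd]
      simp
      omega
  · simp at h2; omega
  · exact key c hc (Or.inl ht.symm)
  · simp at h2; omega
  · exact key c hc (Or.inr ht.symm)
  · simp at h2; omega

lemma ribbon_exists_below (hn : 1 ≤ n₁)
    {p : benzenoidVertices (ribbonCells n₁ n₂ m₁ m₂)} (hp : p.1.2 % 3 = 1)
    (hp0 : ¬ (p.1.1 = m₁ + m₂ - (n₁ + n₂) ∧ p.1.2 = 4 - 3 * (n₁ + n₂ + (m₁ + m₂)))) :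
    ∃ q : benzenoidVertices (ribbonCells n₁ n₂ m₁ m₂), q.1.1 = p.1.1 ∧ q.1.2 = p.1.2 - 2 := by
  have key : ∀ c ∈ ribbonCells n₁ n₂ m₁ m₂, p.1 = hexCorner c 1 ∨ p.1 = hexCorner c 5 →
      ∃ q : benzenoidVertices (ribbonCells n₁ n₂ m₁ m₂), q.1.1 = p.1.1 ∧ q.1.2 = p.1.2 - 2 := by
    rintro c hc (h | h)
    · refine ⟨⟨_, hexCorner_mem hc 2⟩, ?_, ?_⟩
      · rw [h, hexCorner_fst, hexCorner_fst]
        simp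
      · rw [h, hexCorner_snd, hexCorner_snd]
        simp
        ring
    · refine ⟨⟨_, hexCorner_mem hc 4⟩, ?_, ?_⟩
      · rw [h, hexCorner_fst, hexCorner_fst]
        simp
      · rw [h, hexCorner_snd, hexCorner_snd]
        simp
        ring
  obtain ⟨c, hc, t, ht⟩ := mem_benzenoidVertices.1 p.2
  have h1 := hexCorner_fst c t
  have h2 := hexCorner_snd c t
  have hc' := mem_ribbonCells.1 hc
  rw [ht] at h1 h2
  fin_cases t
  · simp at h2; omega
  · exact key c hc (Or.inl ht.symm)
  · simp at h2; omega
  · simp at h1 h2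
    -- By `n₁ ≥ 1` the last row belongs to the lower arm and runs to `m₁ + m₂`, so only the sink has
    -- no cell below it on either side.
    by_cases h0 : c.1 + 1 < n₁ + n₂
    · refine key (c.1 + 1, c.2) (mem_ribbonCells.2 (by simp only; omega)) (Or.inl ?_)
      rw [Prod.ext_iff, hexCorner_fst, hexCorner_snd]
      simp
      omega
    · refine key (c.1, c.2 + 1) (mem_ribbonCells.2 (by simp only; omega)) (Or.inr ?_)
      rw [Prod.ext_iff, hexCorner_fst, hexCorner_snd]
      simp
      omega
  · simp at h2; omega
  · exact key c hc (Or.inr ht.symm)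

/-- A set of vertices that is a union of vertical edges has a unique Clar cover. -/
lemma ribbon_coverPoly_of_paired (hn : 1 ≤ n₁) (hs : σ = 0 ∧ 1 ≤ m₁ ∨ σ = n₂ ∧ m₁ = 0)
    (W : Set (benzenoidVertices (ribbonCells n₁ n₂ m₁ m₂)))
    (hpair : ∀ p q, q.1.1 = p.1.1 → q.1.2 = p.1.2 + 2 → p.1.2 % 3 = 2 → (p ∈ W ↔ q ∈ W))
    (hsource : ∀ p ∈ W, ¬ (p.1.1 = -σ ∧ p.1.2 = 2 - 3 * σ))
    (hsink : ∀ p ∈ W,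
      ¬ (p.1.1 = m₁ + m₂ - (n₁ + n₂) ∧ p.1.2 = 4 - 3 * (n₁ + n₂ + (m₁ + m₂)))) :
    coverPoly (ribbon n₁ n₂ m₁ m₂) W = 1 := by
  induction hk : W.ncard using Nat.strong_induction_on generalizing W with
  | _ k ih =>
    rcases W.eq_empty_or_nonempty with rfl | hne
    · exact coverPoly_empty _
    -- A lowest vertex of `W` has its vertical partner above it, and its other neighbours are lower,
    -- hence outside `W`: its bond is forced.
    obtain ⟨p, hpW, hmin⟩ := W.exists_min_image (fun p => p.1.2) W.toFinite hne
    have hp2 : p.1.2 % 3 = 2 := by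
      refine (benzenoid_vertex_mod p).resolve_left fun h1 => ?_
      obtain ⟨q, hq1, hq2⟩ := ribbon_exists_below hn h1 (hsink p hpW)
      have := hmin q ((hpair q p (by omega) (by omega) (by omega)).2 hpW)
      omega
    obtain ⟨q, hq1, hq2, hadj⟩ := ribbon_exists_above hs hp2 (hsource p hpW)
    have hqW : q ∈ W := (hpair p q hq1 hq2 hp2).1 hpW
    rw [coverPoly_of_unique_neighbor hpW hqW hadj]
    · have hW : ∀ x, x ∈ W \ {p, q} ↔ x ∈ W ∧ ¬ (x.1.1 = p.1.1 ∧ x.1.2 = p.1.2) ∧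
          ¬ (x.1.1 = p.1.1 ∧ x.1.2 = p.1.2 + 2) := by
        intro x
        simp only [mem_sdiff, mem_insert_iff, mem_singleton_iff, vertex_ext_iff, hq1, hq2, not_or]
      refine ih _ ?_ _ ?_ (fun x hx => hsource x hx.1) (fun x hx => hsink x hx.1) rfl
      · rw [← hk]
        exact ncard_lt_ncard ⟨sdiff_subset, fun h => (h hpW).2 (Or.inl rfl)⟩
      · intro x y h1 h2 h3
        have := hpair x y h1 h2 h3
        rw [hW, hW]
        constructor
        · exact fun hx => ⟨this.1 hx.1, by omega, by omega⟩
        · exact fun hx => ⟨this.2 hx.1, by omega, by omega⟩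
    · intro w hw hpw
      have h1 := benzenoid_adj_coords hpw
      have h2 := hmin w hw
      rw [vertex_ext_iff]
      omega

end Ribbon

/-! ### Clar covers of ribbons as lattice paths -/

section RibbonPoly

open Set PathState

variable {σ : ℤ} {n₁ n₂ m₁ m₂ : ℕ}

lemma ribbon_coords_of_mem (p : benzenoidVertices (ribbonCells n₁ n₂ m₁ m₂)) :
    ∃ a b : ℤ, (0 ≤ a ∧ a < n₁ + n₂ ∧ 0 ≤ b ∧ (b < m₁ ∨ n₂ ≤ a ∧ b < m₁ + m₂)) ∧
      (p.1.1 = b - a ∧ p.1.2 = 2 - 3 * (a + b) ∨ p.1.1 = b - a + 1 ∧ p.1.2 = 1 - 3 * (a + b) ∨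
      p.1.1 = b - a + 1 ∧ p.1.2 = -1 - 3 * (a + b) ∨ p.1.1 = b - a ∧ p.1.2 = -2 - 3 * (a + b) ∨
      p.1.1 = b - a - 1 ∧ p.1.2 = -1 - 3 * (a + b) ∨
      p.1.1 = b - a - 1 ∧ p.1.2 = 1 - 3 * (a + b)) := by
  obtain ⟨c, hc, t, ht⟩ := mem_benzenoidVertices.1 p.2
  refine ⟨c.1, c.2, mem_ribbonCells.1 hc, ?_⟩
  have h1 := hexCorner_fst c t
  have h2 := hexCorner_snd c t
  rw [ht] at h1 h2
  fin_cases t <;> simp at h1 h2 <;> omega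

lemma PathState.neighbor {S : Finset (ℤ × ℤ)} {i j : ℤ} {W : Set (benzenoidVertices S)}
    (hW : PathState σ i j W) {u w : benzenoidVertices S} (hu₁ : u.1.1 = j - i)
    (hu₂ : u.1.2 = 2 - 3 * (i + j)) (hw : w ∈ W) (huw : (benzenoid S).Adj u w) :
    w.1.1 = j - i + 1 ∧ w.1.2 = 1 - 3 * (i + j) ∨ w.1.1 = j - i - 1 ∧ w.1.2 = 1 - 3 * (i + j) := by
  have h := benzenoid_adj_coords huw
  have h' : ¬ (w.1.1 = j - i ∧ w.1.2 = 4 - 3 * (i + j)) :=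
    fun hh => hW.current_notMem w hh.1 hh.2 hw
  omega

/-- At a point below which there is a cell, a path can turn right, turn left, or cross the cell. -/
lemma PathState.coverPoly_of_mem {S : Finset (ℤ × ℤ)} {i j : ℤ} {W : Set (benzenoidVertices S)}
    (hW : PathState σ i j W) (hc : (i, j) ∈ S) :
    ∃ W₁ W₂ W₃, PathState σ i (j + 1) W₁ ∧ PathState σ (i + 1) j W₂ ∧
      PathState σ (i + 1) (j + 1) W₃ ∧
      coverPoly (benzenoid S) W = coverPoly (benzenoid S) W₁ + coverPoly (benzenoid S) W₂ +
        X * coverPoly (benzenoid S) W₃ := by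
  obtain ⟨f, hf⟩ : ∃ f : Fin 6 → benzenoidVertices S, ∀ t, (f t).1 = hexCorner (i, j) t :=
    ⟨fun t => ⟨_, hexCorner_mem hc t⟩, fun _ => rfl⟩
  have hfst : ∀ t, (f t).1.1 = j - i + ![0, 1, 1, 0, -1, -1] t := fun t => by
    rw [hf, hexCorner_fst]
  have hsnd : ∀ t, (f t).1.2 = ![2, 1, -1, -2, -1, 1] t - 3 * (i + j) := fun t => by
    rw [hf, hexCorner_snd]
  have h0 : (f 0).1.1 = j - i ∧ (f 0).1.2 = 2 - 3 * (i + j) := by simp [hfst, hsnd]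
  have h1 : (f 1).1.1 = j - i + 1 ∧ (f 1).1.2 = 1 - 3 * (i + j) := by simp [hfst, hsnd]
  have h5 : (f 5).1.1 = j - i - 1 ∧ (f 5).1.2 = 1 - 3 * (i + j) := by
    simp [hfst, hsnd, sub_eq_add_neg]
  refine ⟨_, _, _, hW.step_right h0.1 h0.2 h1.1 h1.2, hW.step_left h0.1 h0.2 h5.1 h5.2,
    hW.step_diagonal hf, coverPoly_of_two_neighbors ?_ ?_ ?_ ?_ ?_⟩
  · intro s t hst
    exact hexCorner_injective (i, j) (by rw [← hf, ← hf, hst])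
  · intro t
    by_cases ht : t = 0
    · subst ht
      exact hW.current_mem _ h0.1 h0.2
    · refine hW.below _ ?_
      rw [hsnd]
      fin_cases t <;> simp at ht ⊢
  · exact fun t => benzenoid_adj_of_corner hc t (hf t) (hf (t + 1))
  · intro w hw hadj
    rw [vertex_ext_iff, vertex_ext_iff, h1.1, h1.2, h5.1, h5.2]
    exact hW.neighbor h0.1 h0.2 hw hadj
  · intro x y z hx hy hz hb hx0 hy1 hz0
    rw [Ne, vertex_ext_iff, h0.1, h0.2] at hx0 hz0
    rw [Ne, vertex_ext_iff, h1.1, h1.2] at hy1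
    have := benzenoid_hexagon_unique h1 h5 hx hy hz hb hx0 hy1 hz0
    simpa [vertex_ext_iff, hfst, hsnd, sub_eq_add_neg] using this

/-- The Clar covers of what remains of a ribbon when a path has arrived at the point `(i, j)`
correspond to the continuations of that path. -/
theorem ribbon_coverPoly_of_pathState (hn : 1 ≤ n₁) (hm : 1 ≤ m₁ + m₂) (hs : σ = 0 ∧ 1 ≤ m₁ ∨ σ = n₂ ∧ m₁ = 0)
    {i j : ℤ} (hi : σ ≤ i) (hi' : i ≤ n₁ + n₂) (hj : 0 ≤ j)
    (hj' : j ≤ m₁ ∨ n₂ ≤ i ∧ j ≤ m₁ + m₂)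
    {W : Set (benzenoidVertices (ribbonCells n₁ n₂ m₁ m₂))} (hW : PathState σ i j W) :
    coverPoly (ribbon n₁ n₂ m₁ m₂) W = pathSum n₁ n₂ m₁ m₂ i j := by
  induction hk : (n₁ + n₂ + (m₁ + m₂) - (i + j)).toNat using Nat.strong_induction_on
    generalizing i j W with
  | _ k ih =>
  -- the corners of a cell, as vertices
  have corner : ∀ (c : ℤ × ℤ) (_ : c ∈ ribbonCells n₁ n₂ m₁ m₂) (t : Fin 6),
      ∃ p : benzenoidVertices (ribbonCells n₁ n₂ m₁ m₂), p.1 = hexCorner c t :=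
    fun c hc t => ⟨⟨_, hexCorner_mem hc t⟩, rfl⟩
  by_cases hcell : i < n₁ + n₂ ∧ (j < m₁ ∨ n₂ ≤ i ∧ j < m₁ + m₂)
  · have hc : (i, j) ∈ ribbonCells n₁ n₂ m₁ m₂ := mem_ribbonCells.2 (by simp only; omega)
    obtain ⟨W₁, W₂, W₃, h₁, h₂, h₃, h⟩ := hW.coverPoly_of_mem hc
    rw [ribbon, h, pathSum_of_cell (by omega) hj (by omega), ← ribbon,
      ih _ (by omega) hi (by omega) (by omega) (by omega) h₁ rfl,
      ih _ (by omega) (by omega) (by omega) hj (by omega) h₂ rfl,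
      ih _ (by omega) (by omega) (by omega) (by omega) (by omega) h₃ rfl]
  · by_cases hend : i = n₁ + n₂ ∧ j = m₁ + m₂
    · obtain ⟨rfl, rfl⟩ := hend
      rw [pathSum_end]
      refine ribbon_coverPoly_of_paired hn hs W ?_ ?_ ?_
      -- At the end point the lower end of the vertical edge is not a vertex of the ribbon, so
      -- `pair` applies without exception.
      · intro p q h1 h2 h3
        refine hW.pair p q h1 h2 h3 ?_
        obtain ⟨a, b, hab, h⟩ := ribbon_coords_of_mem p
        omega
      · intro p hp h
        have := hW.source p hp h.1 h.2
        omega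
      · exact fun p hp h => hW.current_notMem p h.1 h.2 hp
    -- On the lower left border the path can only continue to the right, through the bottom corner
    -- of the cell `(i - 1, j)`.
    by_cases hrow : i = n₁ + n₂
    · have hc : (i - 1, j) ∈ ribbonCells n₁ n₂ m₁ m₂ := mem_ribbonCells.2 (by simp only; omega)
      obtain ⟨u, hu⟩ := corner _ hc 4
      obtain ⟨a, ha⟩ := corner _ hc 3
      have hadj : (ribbon n₁ n₂ m₁ m₂).Adj u a := (benzenoid_adj_of_corner hc 3 ha hu).symm
      rw [Prod.ext_iff, hexCorner_fst, hexCorner_snd] at hu ha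
      simp at hu ha
      rw [coverPoly_of_unique_neighbor (hW.current_mem u (by omega) (by omega))
        (hW.below a (by omega)) hadj]
      · rw [ih _ (by omega) hi hi' (by omega) (by omega)
          (hW.step_right (by omega) (by omega) (by omega) (by omega)) rfl, hrow,
          pathSum_of_last_row hj (by omega)]
      · intro w hw huw
        have h := hW.neighbor (by omega) (by omega) hw huw
        obtain ⟨b, c, hbc, h''⟩ := ribbon_coords_of_mem w
        rw [vertex_ext_iff]
        omega
    -- On a right border, either `j = m₁ + m₂` or the inner one `j = m₁` with `i < n₂`, the path can
    -- only continue to the left.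
    · have hc : (i, j - 1) ∈ ribbonCells n₁ n₂ m₁ m₂ := mem_ribbonCells.2 (by simp only; omega)
      obtain ⟨u, hu⟩ := corner _ hc 2
      obtain ⟨a, ha⟩ := corner _ hc 3
      have hadj : (ribbon n₁ n₂ m₁ m₂).Adj u a := benzenoid_adj_of_corner hc 2 hu ha
      rw [Prod.ext_iff, hexCorner_fst, hexCorner_snd] at hu ha
      simp at hu ha
      rw [coverPoly_of_unique_neighbor (hW.current_mem u (by omega) (by omega))
        (hW.below a (by omega)) hadj]
      · rw [ih _ (by omega) (by omega) (by omega) hj (by omega)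
          (hW.step_left (by omega) (by omega) (by omega) (by omega)) rfl,
          pathSum_of_last_column (i := i) (by omega) (by omega)]
      · intro w hw huw
        have h := hW.neighbor (by omega) (by omega) hw huw
        obtain ⟨b, c, hbc, h''⟩ := ribbon_coords_of_mem w
        rw [vertex_ext_iff]
        omega

lemma pathState_univ (hs : σ = 0 ∧ 1 ≤ m₁ ∨ σ = n₂ ∧ m₁ = 0) :
    PathState σ σ 0 (univ : Set (benzenoidVertices (ribbonCells n₁ n₂ m₁ m₂))) := by
  refine ⟨fun p _ _ => mem_univ p, fun p h1 h2 _ => ?_, fun p q _ _ _ _ => by simp,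
    fun p _ => mem_univ p, fun p _ _ _ => ⟨rfl, rfl⟩⟩
  obtain ⟨a, b, hab, h⟩ := ribbon_coords_of_mem p
  omega

lemma ZZ_ribbon_eq_pathSum (hn : 1 ≤ n₁) (hm : 1 ≤ m₁ + m₂)
    (hs : σ = 0 ∧ 1 ≤ m₁ ∨ σ = n₂ ∧ m₁ = 0) :
    ZZ (ribbon n₁ n₂ m₁ m₂) = pathSum n₁ n₂ m₁ m₂ σ 0 := by
  rw [ZZ_eq_coverPoly_univ]
  exact ribbon_coverPoly_of_pathState hn hm hs le_rfl (by omega) le_rfl (by omega)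
    (pathState_univ hs)

lemma ZZ_benzenoid_empty {S : Finset (ℤ × ℤ)} (hS : S = ∅) : ZZ (benzenoid S) = 1 := by
  subst hS
  rw [ZZ_eq_coverPoly_univ]
  rw [show (univ : Set (benzenoidVertices ∅)) = ∅ from
    eq_empty_of_forall_notMem fun p => absurd p.2 (by simp [benzenoidVertices])]
  exact coverPoly_empty _

/-- Without an upper arm the source is `(n₂, 0)`, already on the antidiagonal, so the path count is
a single Delannoy polynomial. Parallelograms are obtained from this case. -/
lemma ZZ_ribbon_of_eq_zero (hn : 1 ≤ n₁) (hm : 1 ≤ m₂) :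
    ZZ (ribbon n₁ n₂ 0 m₂) = delannoy m₂ n₁ := by
  rw [ZZ_ribbon_eq_pathSum hn (by omega) (Or.inr ⟨rfl, rfl⟩), pathSum_of_le (by simp),
    ← delannoyInt_natCast]
  simp

theorem ZZ_parallelogram (m n : ℕ) : ZZ (parallelogram m n) = delannoy m n := by
  rcases Nat.eq_zero_or_pos m with rfl | hm
  · rw [delannoy_zero_left]
    exact ZZ_benzenoid_empty (by simp [parallelogramCells])
  rcases Nat.eq_zero_or_pos n with rfl | hn
  · rw [delannoy_zero_right]
    exact ZZ_benzenoid_empty (by simp [parallelogramCells])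
  have hS : parallelogramCells m n = ribbonCells n 0 0 m := by
    ext c
    rw [mem_ribbonCells]
    simp only [parallelogramCells, Finset.mem_product, Finset.mem_Ico]
    omega
  have h : ZZ (benzenoid (ribbonCells n 0 0 m)) = delannoy m n :=
    ZZ_ribbon_of_eq_zero hn (by omega)
  rw [parallelogram, hS, h]

theorem ZZ_ribbon (n₁ n₂ m₁ m₂ : ℕ) :
    ZZ (ribbon n₁ n₂ m₁ m₂) =
      ∑ k ∈ Finset.Icc 0 (min n₁ m₁), delannoy (m₁ - k) (n₂ + k) * delannoy (m₂ + k) (n₁ - k) +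
      X * ∑ k ∈ Finset.Icc 1 (min n₁ m₁),
        delannoy (m₁ - k) (n₂ + k - 1) * delannoy (m₂ + k - 1) (n₁ - k) := by
  -- The path argument needs `n₁ ≥ 1`; otherwise the lower arm is empty and the ribbon is a
  -- parallelogram.
  rcases Nat.eq_zero_or_pos n₁ with rfl | hn
  · have hS : ribbonCells 0 n₂ m₁ m₂ = parallelogramCells m₁ n₂ := by
      ext c
      rw [mem_ribbonCells]
      simp only [parallelogramCells, Finset.mem_product, Finset.mem_Ico]
      omega
    rw [ribbon, hS]
    have := ZZ_parallelogram m₁ n₂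
    rw [parallelogram] at this
    simp [this]
  rcases Nat.eq_zero_or_pos m₁ with rfl | hm
  · rcases Nat.eq_zero_or_pos m₂ with rfl | hm₂
    · rw [ribbon, ZZ_benzenoid_empty (by ext c; simp [mem_ribbonCells]; omega)]
      simp
    · rw [ZZ_ribbon_of_eq_zero hn hm₂]
      simp
  rw [ZZ_ribbon_eq_pathSum hn (by omega) (Or.inl ⟨rfl, hm⟩),
    pathSum_eq_crossingSum (by omega) (by omega) le_rfl (by omega), crossingSum]
  congr 1
  · refine Finset.sum_congr rfl fun k hk => ?_
    rw [Finset.mem_Icc] at hk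
    rw [← delannoyInt_natCast (m₁ - k)]
    congr 2
    omega
  · congr 1
    refine Finset.sum_congr rfl fun k hk => ?_
    rw [Finset.mem_Icc] at hk
    -- Since `1 ≤ k ≤ m₁`, none of the subtractions in the first factor truncates, even for `n₂ =
    -- 0`.
    rw [← delannoyInt_natCast (m₁ - k)]
    congr 2 <;> omega

end RibbonPoly

/-! ### Binomial and hypergeometric forms -/

section Formulas

lemma delannoy_comm (m n : ℕ) : delannoy m n = delannoy n m := by
  rw [delannoy_eq_sum, delannoy_eq_sum, min_comm]
  exact Finset.sum_congr rfl fun j _ => by ring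

/-- The ranges end at `a` and `d`, which bound the respective minima; in the ribbon formula these
are `m₁ - k` and `n₁ - k`. -/
lemma delannoy_mul_delannoy (a b c d : ℕ) :
    delannoy a b * delannoy c d =
      ∑ j ∈ Finset.Icc 0 a, ∑ i ∈ Finset.Icc 0 d,
        (a.choose j * b.choose j * c.choose i * d.choose i : ℤ[X]) * (1 + X) ^ (i + j) := by
  rw [delannoy_eq_sum_range a b a (min_le_left _ _), delannoy_eq_sum_range c d d (min_le_right _ _),
    Finset.sum_mul_sum, Finset.range_eq_Ico, Finset.range_eq_Ico]
  refine Finset.sum_congr rfl fun j _ => Finset.sum_congr rfl fun i _ => ?_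
  rw [pow_add]
  ring

theorem ZZ_ribbon_eq_triple_sum (n₁ n₂ m₁ m₂ : ℕ) :
    ZZ (ribbon n₁ n₂ m₁ m₂) =
      ∑ k ∈ Finset.Icc 0 (min n₁ m₁), ∑ j ∈ Finset.Icc 0 (m₁ - k), ∑ i ∈ Finset.Icc 0 (n₁ - k),
        ((m₁ - k).choose j * (n₂ + k).choose j * (m₂ + k).choose i * (n₁ - k).choose i : ℤ[X]) *
          (1 + X) ^ (i + j) +
      X * ∑ k ∈ Finset.Icc 1 (min n₁ m₁),
        ∑ j ∈ Finset.Icc 0 (m₁ - k), ∑ i ∈ Finset.Icc 0 (n₁ - k),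
        ((m₁ - k).choose j * (n₂ + k - 1).choose j * (m₂ + k - 1).choose i *
          (n₁ - k).choose i : ℤ[X]) * (1 + X) ^ (i + j) := by
  simp only [ZZ_ribbon, delannoy_mul_delannoy]

theorem aeval_ZZ_ribbon (n₁ n₂ m₁ m₂ : ℕ) (x : ℂ) :
    aeval x (ZZ (ribbon n₁ n₂ m₁ m₂)) =
      ∑ k ∈ Finset.Icc 0 (min n₁ m₁),
        ₂F₁ (-m₁ + k : ℂ) (-n₂ - k : ℂ) (1 : ℂ) (1 + x) *
          ₂F₁ (-n₁ + k : ℂ) (-m₂ - k : ℂ) (1 : ℂ) (1 + x) +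
      x * ∑ k ∈ Finset.Icc 1 (min n₁ m₁),
        ₂F₁ (-m₁ + k : ℂ) (-n₂ + 1 - k : ℂ) (1 : ℂ) (1 + x) *
          ₂F₁ (-n₁ + k : ℂ) (-m₂ + 1 - k : ℂ) (1 : ℂ) (1 + x) := by
  simp only [ZZ_ribbon, map_add, map_sum, map_mul, aeval_X]
  congr 1
  · refine Finset.sum_congr rfl fun k hk => ?_
    obtain ⟨-, hk⟩ := Finset.mem_Icc.1 hk
    -- Symmetry puts the parameter from `n₁ - k` first, as in the stated hypergeometric form.
    rw [delannoy_comm (m₂ + k), aeval_delannoy, aeval_delannoy,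
      Nat.cast_sub (by omega : k ≤ m₁), Nat.cast_sub (by omega : k ≤ n₁)]
    push_cast
    congr 2 <;> ring
  · congr 1
    refine Finset.sum_congr rfl fun k hk => ?_
    obtain ⟨hk1, hk⟩ := Finset.mem_Icc.1 hk
    rw [delannoy_comm (m₂ + k - 1), aeval_delannoy, aeval_delannoy,
      Nat.cast_sub (by omega : k ≤ m₁), Nat.cast_sub (by omega : k ≤ n₁),
      Nat.cast_sub (by omega : 1 ≤ n₂ + k), Nat.cast_sub (by omega : 1 ≤ m₂ + k)]
    push_cast
    congr 2 <;> ring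

end Formulas

end

theorem mainTheorem1 :
    -- the ZZ polynomial of a ribbon in terms of those of parallelograms
    (∀ n₁ n₂ m₁ m₂ : ℕ,
      ZZ (ribbon n₁ n₂ m₁ m₂) =
        ∑ k ∈ Finset.Icc 0 (min n₁ m₁),
          ZZ (parallelogram (m₁ - k) (n₂ + k)) * ZZ (parallelogram (m₂ + k) (n₁ - k)) +
        X * ∑ k ∈ Finset.Icc 1 (min n₁ m₁),
          ZZ (parallelogram (m₁ - k) (n₂ + k - 1)) * ZZ (parallelogram (m₂ + k - 1) (n₁ - k))) ∧
    -- the ZZ polynomial of a parallelogram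
    (∀ m n : ℕ,
      ZZ (parallelogram m n) =
        ∑ j ∈ Finset.Icc 0 (min m n), (m.choose j * n.choose j : ℤ[X]) * (1 + X) ^ j) ∧
    (∀ (m n : ℕ) (x : ℂ),
      aeval x (ZZ (parallelogram m n)) = ₂F₁ (-m : ℂ) (-n : ℂ) (1 : ℂ) (1 + x)) ∧
    -- the hypergeometric form for a ribbon
    (∀ (n₁ n₂ m₁ m₂ : ℕ) (x : ℂ),
      aeval x (ZZ (ribbon n₁ n₂ m₁ m₂)) =
        ∑ k ∈ Finset.Icc 0 (min n₁ m₁),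
          ₂F₁ (-m₁ + k : ℂ) (-n₂ - k : ℂ) (1 : ℂ) (1 + x) *
            ₂F₁ (-n₁ + k : ℂ) (-m₂ - k : ℂ) (1 : ℂ) (1 + x) +
        x * ∑ k ∈ Finset.Icc 1 (min n₁ m₁),
          ₂F₁ (-m₁ + k : ℂ) (-n₂ + 1 - k : ℂ) (1 : ℂ) (1 + x) *
            ₂F₁ (-n₁ + k : ℂ) (-m₂ + 1 - k : ℂ) (1 : ℂ) (1 + x)) ∧
    -- the triple binomial sum for a ribbon
    (∀ n₁ n₂ m₁ m₂ : ℕ,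
      ZZ (ribbon n₁ n₂ m₁ m₂) =
        ∑ k ∈ Finset.Icc 0 (min n₁ m₁), ∑ j ∈ Finset.Icc 0 (m₁ - k), ∑ i ∈ Finset.Icc 0 (n₁ - k),
          ((m₁ - k).choose j * (n₂ + k).choose j * (m₂ + k).choose i * (n₁ - k).choose i : ℤ[X]) *
            (1 + X) ^ (i + j) +
        X * ∑ k ∈ Finset.Icc 1 (min n₁ m₁),
          ∑ j ∈ Finset.Icc 0 (m₁ - k), ∑ i ∈ Finset.Icc 0 (n₁ - k),
          ((m₁ - k).choose j * (n₂ + k - 1).choose j * (m₂ + k - 1).choose i *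
            (n₁ - k).choose i : ℤ[X]) * (1 + X) ^ (i + j)) ∧
    -- the triple binomial sum for `V(k, m, n)`
    (∀ k m n : ℕ, k ≤ m → k ≤ n →
      ZZ (ribbonV k m n) =
        ∑ s ∈ Finset.Icc 0 k, ∑ j ∈ Finset.Icc 0 (k - s), ∑ i ∈ Finset.Icc 0 (k - s),
          ((k - s).choose j * (n - k + s).choose j * (m - k + s).choose i *
            (k - s).choose i : ℤ[X]) * (1 + X) ^ (i + j) +
        X * ∑ s ∈ Finset.Icc 1 k, ∑ j ∈ Finset.Icc 0 (k - s), ∑ i ∈ Finset.Icc 0 (k - s),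
          ((k - s).choose j * (n - k + s - 1).choose j * (m - k + s - 1).choose i *
            (k - s).choose i : ℤ[X]) * (1 + X) ^ (i + j)) ∧
    -- the triple binomial sum for `V(k₁, k₂, m, n)`
    (∀ k₁ k₂ m n : ℕ, k₁ ≤ n → k₂ ≤ m →
      ZZ (ribbonV₂ k₁ k₂ m n) =
        ∑ k ∈ Finset.Icc 0 (min k₁ k₂),
          ∑ j ∈ Finset.Icc 0 (k₂ - k), ∑ i ∈ Finset.Icc 0 (k₁ - k),
          ((k₂ - k).choose j * (n - k₁ + k).choose j * (m - k₂ + k).choose i *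
            (k₁ - k).choose i : ℤ[X]) * (1 + X) ^ (i + j) +
        X * ∑ k ∈ Finset.Icc 1 (min k₁ k₂),
          ∑ j ∈ Finset.Icc 0 (k₂ - k), ∑ i ∈ Finset.Icc 0 (k₁ - k),
          ((k₂ - k).choose j * (n - k₁ + k - 1).choose j * (m - k₂ + k - 1).choose i *
            (k₁ - k).choose i : ℤ[X]) * (1 + X) ^ (i + j)) := by
  refine ⟨fun n₁ n₂ m₁ m₂ => ?_, fun m n => ?_, fun m n x => ?_, aeval_ZZ_ribbon,
    ZZ_ribbon_eq_triple_sum, fun k m n _ _ => ?_, fun k₁ k₂ m n _ _ => ?_⟩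
  · simp only [ZZ_parallelogram, ZZ_ribbon]
  · rw [ZZ_parallelogram, delannoy_eq_sum]
  · rw [ZZ_parallelogram, aeval_delannoy]
  · rw [ribbonV, ZZ_ribbon_eq_triple_sum, min_self]
  · rw [ribbonV₂, ZZ_ribbon_eq_triple_sum]
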